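/- Let $n\ge 2$ and $s\in\mathbb R$ be such that either $n=2$ and $s\in(0,1)$, or $n\ge 3$ and $s\in[0,1)$. Let $\Omega\subset\mathbb{R}^n$ be a bounded, connected, nonempty open set with infinitely differentiable boundary (near each point of $\partial\Omega$, $\Omega$ is the set $\{\rho<0\}$ for a $C^\infty$ function $\rho$ with non-vanishing differential at that point). Let $d\in C^\infty(\overline\Omega)$ be strictly positive in $\Omega$ and such that the quotient $d(x)/\mathrm{dist}(x,\partial\Omega)$ is infinitely differentiable in a neighborhood of $\partial\Omega$ in $\overline\Omega$, up to and including $\partial\Omega$, with positive values on $\partial\Omega$. Let $m\ge 0$ be an integer and let $\phi\in C^m(\overline\Omega)$ be real- or complex-valued. Then, for every $x\in\overline\Omega$, the integral $$F_s[\phi](x)=\int_\Omega \frac{d(y)^s\,\phi(y)}{|x-y|^{n+2s-2}}\,dy$$ converges absolutely, and the restriction of $F_s[\phi]$ to $\partial\Omega$ satisfies $$F_s[\phi]\big|_{\partial\Omega}\in C^{m+1}(\partial\Omega),$$ that is, near each point of $\partial\Omega$ it coincides on $\partial\Omega$ with a function of class $C^{m+1}$ on an open subset of $\mathbb{R}^n$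 (equivalently, it is of class $C^{m+1}$ in every smooth local parametrization of $\partial\Omega$). -/

import Mathlib

open scoped ContDiff

/-- The open set `Ω ⊆ ℝⁿ` has an infinitely differentiable boundary and lies locally on one side
of it: near each boundary point, `Ω` is the sublevel set `{ρ < 0}` of a smooth function `ρ` whose
derivative at that point does not vanish. -/
def HasSmoothBoundary {n : ℕ} (Ω : Set (EuclideanSpace ℝ (Fin n))) : Prop :=
  ∀ z ∈ frontier Ω, ∃ (U : Set (EuclideanSpace ℝ (Fin n))) (ρ : EuclideanSpace ℝ (Fin n) → ℝ),
    IsOpen U ∧ z ∈ U ∧ ContDiffOn ℝ ∞ ρ U ∧ ρ z = 0 ∧ fderiv ℝ ρ z ≠ 0 ∧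
      ∀ x ∈ U, x ∈ Ω ↔ ρ x < 0

/-- The weight `d`: it belongs to `C^∞(closure Ω)`, is strictly positive in `Ω`, and, in a
neighbourhood of `∂Ω`, the quotient `d / dist(·, ∂Ω)` (defined at points of `Ω`) extends to a
function `q` that is infinitely differentiable up to and including the boundary, and that is
positive on the boundary. -/
structure IsSmoothDistance {n : ℕ} (Ω : Set (EuclideanSpace ℝ (Fin n)))
    (d : EuclideanSpace ℝ (Fin n) → ℝ) : Prop where
  contDiffOn : ContDiffOn ℝ ∞ d (closure Ω)
  pos : ∀ x ∈ Ω, 0 < d x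
  quotient : ∃ (U : Set (EuclideanSpace ℝ (Fin n))) (q : EuclideanSpace ℝ (Fin n) → ℝ),
    IsOpen U ∧ frontier Ω ⊆ U ∧ ContDiffOn ℝ ∞ q (U ∩ closure Ω) ∧
      (∀ x ∈ U ∩ Ω, d x / Metric.infDist x (frontier Ω) = q x) ∧
      (∀ x ∈ frontier Ω, 0 < q x)

/-- The integrand `y ↦ d(y)^s φ(y) / |x - y|^(n + 2s - 2)`. -/
noncomputable def potentialIntegrand {n : ℕ} {𝕜 : Type*} [RCLike 𝕜] (s : ℝ)
    (d : EuclideanSpace ℝ (Fin n) → ℝ) (φ : EuclideanSpace ℝ (Fin n) → 𝕜)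
    (x y : EuclideanSpace ℝ (Fin n)) : 𝕜 :=
  (d y ^ s / ‖x - y‖ ^ ((n : ℝ) + 2 * s - 2)) • φ y

/-- The potential `F_s[φ](x) = ∫_Ω d(y)^s φ(y) / |x - y|^(n + 2s - 2) dy`. -/
noncomputable def potentialF {n : ℕ} {𝕜 : Type*} [RCLike 𝕜]
    (Ω : Set (EuclideanSpace ℝ (Fin n))) (s : ℝ) (d : EuclideanSpace ℝ (Fin n) → ℝ)
    (φ : EuclideanSpace ℝ (Fin n) → 𝕜) (x : EuclideanSpace ℝ (Fin n)) : 𝕜 :=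
  ∫ y in Ω, potentialIntegrand s d φ x y

/-- `g` restricted to `S ⊆ ℝⁿ` is of class `C^k`: near each point of `S` it coincides on `S` with
a `C^k` function of the ambient variables. On a smooth hypersurface `S` this is the same as being
`C^k` in every smooth local parametrization of `S`. Only the values of `g` on `S` matter. -/
def IsCkOnSurface {n : ℕ} {𝕜 : Type*} [RCLike 𝕜] (k : ℕ)
    (S : Set (EuclideanSpace ℝ (Fin n))) (g : EuclideanSpace ℝ (Fin n) → 𝕜) : Prop :=
  ∀ z ∈ S, ∃ (U : Set (EuclideanSpace ℝ (Fin n))) (G : EuclideanSpace ℝ (Fin n) → 𝕜),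
    IsOpen U ∧ z ∈ U ∧ ContDiffOn ℝ k G U ∧ Set.EqOn g G (S ∩ U)

set_option linter.unusedSectionVars false

open MeasureTheory Set Filter Topology

/-! Write `k = n - 1` and `p = n + 2s - 2 = k + 2s - 1`. The density loses nothing and the potential
gains one derivative because, at a boundary point, the weight vanishes where the kernel is singular.
One derivative of the kernel has order `-(k + 2s)`, while `d ^ s` contributes a factor comparable to
`t ^ s`, where `t` is the height above the boundary. The product has order `-(k + s)`, which is
integrable in dimension `k + 1` exactly because `s < 1` (`exists_dominating_product`).

To exploit this, a cutoff splits the density near a boundary point `z`. The part away from `z` gives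
a smooth function near `z` (`exists_contDiff_eq_integral_norm_sub_rpow`). For the other part the
boundary is flattened by a graph chart, which has constant Jacobian. There `d ^ s • φ = t ^ s • g`,
where `g` contains the factor `(d / t) ^ s`. Since `d / t` is bounded below and has `m` bounded
tangential derivatives, so does `g`; normal derivatives of `g` are never needed.

For base points on the boundary, Hadamard's lemma turns the distance in the chart into `‖a‖` times a
smooth function of the base point, of `a` and of `a / ‖a‖` (`exists_profile_graph`). The near part
is thus a half-space potential. Written with the density translated by `x`, its singularity sits at
a fixed point. Each of `m` derivatives in `x` then falls either on `g` or on the profile, and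
neither makes the kernel more singular (`hasFDerivAt_halfSpacePotential`). The last derivative is
taken after undoing the translation, so that it falls on the kernel alone and `g` only has to be
continuous and bounded (`contDiff_one_halfSpacePotential`). -/

theorem ContDiff.exists_bound_fderiv_of_hasCompactSupport {X F : Type*} [NormedAddCommGroup X]
    [NormedSpace ℝ X] [NormedAddCommGroup F] [NormedSpace ℝ F] {f : X → F} (hf : ContDiff ℝ 1 f)
    (hc : HasCompactSupport f) :
    ∃ C₀ C₁ : ℝ, 0 ≤ C₀ ∧ 0 ≤ C₁ ∧ (∀ x, ‖f x‖ ≤ C₀) ∧ ∀ x, ‖fderiv ℝ f x‖ ≤ C₁ := by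
  obtain ⟨C₀, hC₀⟩ := hc.exists_bound_of_continuous hf.continuous
  obtain ⟨C₁, hC₁⟩ := (hc.fderiv (𝕜 := ℝ)).exists_bound_of_continuous
    (hf.continuous_fderiv one_ne_zero)
  exact ⟨C₀, C₁, (norm_nonneg _).trans (hC₀ 0), (norm_nonneg _).trans (hC₁ 0), hC₀, hC₁⟩

/-! ### Kernels with a point singularity and a direction-dependent profile. -/

section SingularKernel

variable {V E : Type*} [NormedAddCommGroup V] [NormedSpace ℝ V]
  [NormedAddCommGroup E] [InnerProductSpace ℝ E]

/-- A kernel which is singular of order `-p` at `a = 0`, with a profile `Ξ` depending on the base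
point `x`, on `a` and on the direction of `a`. -/
noncomputable def singularKernel (p : ℝ) (Ξ : V × E × E → ℝ) (x : V) (a : E) : ℝ :=
  ‖a‖ ^ (-p) * Ξ (x, a, ‖a‖⁻¹ • a)

theorem contDiffOn_singularKernel {N : ℕ∞ω} {p : ℝ} {Ξ : V × E × E → ℝ} (hΞ : ContDiff ℝ N Ξ) :
    ContDiffOn ℝ N (fun q : V × E => singularKernel p Ξ q.1 q.2) {q | q.2 ≠ 0} := by
  intro q hq
  have hq' : ‖q.2‖ ≠ 0 := norm_ne_zero_iff.2 hq
  have hn : ContDiffAt ℝ N (fun q : V × E => ‖q.2‖) q := contDiffAt_snd.norm ℝ hq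
  refine ContDiffAt.contDiffWithinAt (ContDiffAt.mul ?_ ?_)
  · exact hn.rpow_const_of_ne hq'
  · exact hΞ.contDiffAt.comp q
      (contDiffAt_fst.prodMk (contDiffAt_snd.prodMk ((hn.inv hq').smul contDiffAt_snd)))

theorem exists_norm_singularKernel_le {p : ℝ} {Ξ : V × E × E → ℝ} (hΞ : Continuous Ξ)
    (hc : HasCompactSupport Ξ) :
    ∃ C, 0 ≤ C ∧ ∀ x a, ‖singularKernel p Ξ x a‖ ≤ C * ‖a‖ ^ (-p) := by
  obtain ⟨C, hC⟩ := hc.exists_bound_of_continuous hΞ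
  refine ⟨C, (norm_nonneg _).trans (hC 0), fun x a => ?_⟩
  rw [singularKernel, norm_mul, mul_comm, Real.norm_of_nonneg (by positivity : 0 ≤ ‖a‖ ^ (-p))]
  gcongr
  exact hC _

theorem exists_singularKernel_eq_zero {p : ℝ} {Ξ : V × E × E → ℝ} (hc : HasCompactSupport Ξ) :
    ∃ R, 0 < R ∧ ∀ x a, R ≤ ‖a‖ → singularKernel p Ξ x a = 0 := by
  obtain ⟨R, hR, hR'⟩ := hc.isCompact.isBounded.exists_pos_norm_lt
  refine ⟨R, hR, fun x a ha => ?_⟩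
  have : Ξ (x, a, ‖a‖⁻¹ • a) = 0 := by
    by_contra h
    have h1 := hR' _ (subset_tsupport _ h)
    have h2 : ‖a‖ ≤ ‖(x, a, ‖a‖⁻¹ • a)‖ :=
      (norm_fst_le (a, ‖a‖⁻¹ • a)).trans (norm_snd_le (x, a, ‖a‖⁻¹ • a))
    linarith
  rw [singularKernel, this, mul_zero]

theorem hasFDerivAt_inv_norm_smul {a : E} (ha : a ≠ 0) :
    ∃ D : E →L[ℝ] E, HasFDerivAt (fun a : E => ‖a‖⁻¹ • a) D a ∧ ‖D‖ ≤ 2 * ‖a‖⁻¹ := by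
  have ha' : ‖a‖ ≠ 0 := norm_ne_zero_iff.2 ha
  have hd : DifferentiableAt ℝ (fun a : E => ‖a‖) a := differentiableAt_id.norm ℝ ha
  have h1 : ‖fderiv ℝ (fun a : E => ‖a‖) a‖ ≤ 1 := by
    simpa using norm_fderiv_le_of_lipschitz ℝ (x₀ := a) (lipschitzWith_one_norm (E := E))
  have h2 := ((hasDerivAt_inv ha').comp_hasFDerivAt a hd.hasFDerivAt).smul (hasFDerivAt_id a)
  refine ⟨_, h2, (norm_add_le _ _).trans ?_⟩
  have e1 : ‖‖a‖⁻¹ • ContinuousLinearMap.id ℝ E‖ ≤ ‖a‖⁻¹ := by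
    rw [norm_smul, norm_inv, norm_norm]
    exact mul_le_of_le_one_right (by positivity) ContinuousLinearMap.norm_id_le
  refine (add_le_add e1 ?_).trans_eq (two_mul _).symm
  simp only [id, ContinuousLinearMap.norm_smulRight_apply, norm_smul, norm_neg, norm_inv, norm_pow, norm_norm]
  calc (‖a‖ ^ 2)⁻¹ * ‖fderiv ℝ (fun a : E => ‖a‖) a‖ * ‖a‖ ≤ (‖a‖ ^ 2)⁻¹ * 1 * ‖a‖ := by gcongr
    _ = ‖a‖⁻¹ := by field_simp

theorem hasFDerivAt_norm_rpow_neg {a : E} (ha : a ≠ 0) (p : ℝ) :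
    ∃ D : E →L[ℝ] ℝ, HasFDerivAt (fun a : E => ‖a‖ ^ (-p)) D a ∧ ‖D‖ ≤ |p| * ‖a‖ ^ (-p - 1) := by
  have ha' : ‖a‖ ≠ 0 := norm_ne_zero_iff.2 ha
  have hd : DifferentiableAt ℝ (fun a : E => ‖a‖) a := differentiableAt_id.norm ℝ ha
  have h1 : ‖fderiv ℝ (fun a : E => ‖a‖) a‖ ≤ 1 := by
    simpa using norm_fderiv_le_of_lipschitz ℝ (x₀ := a) (lipschitzWith_one_norm (E := E))
  refine ⟨_, hd.hasFDerivAt.rpow_const (Or.inl ha'), ?_⟩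
  rw [norm_smul, norm_mul, norm_neg, Real.norm_eq_abs p,
    Real.norm_of_nonneg (by positivity : 0 ≤ ‖a‖ ^ (-p - 1))]
  exact mul_le_of_le_one_right (by positivity) h1

/-- Differentiation costs one power of `‖a‖`: the direction `a / ‖a‖` has derivative of size `1 /
‖a‖`, and the compact support of `Ξ` keeps all its first derivatives bounded. -/
theorem exists_norm_fderiv_singularKernel_le {p : ℝ} {Ξ : V × E × E → ℝ}
    (hΞ : ContDiff ℝ 1 Ξ) (hc : HasCompactSupport Ξ) :
    ∃ C, 0 ≤ C ∧ ∀ x a, a ≠ 0 →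
      ‖fderiv ℝ (fun q : V × E => singularKernel p Ξ q.1 q.2) (x, a)‖ ≤ C * ‖a‖ ^ (-p - 1) := by
  obtain ⟨C₀, C₁, hC₀', hC₁', hC₀, hC₁⟩ := hΞ.exists_bound_fderiv_of_hasCompactSupport hc
  obtain ⟨R, hR, hR'⟩ := exists_singularKernel_eq_zero (p := p) hc
  -- On `‖a‖ ≤ R` a bound by `1` is also a bound by `R * ‖a‖⁻¹`. This covers the derivatives of `x`
  -- and `a`, while the direction contributes the `2`. The term `C₀ * |p|` comes from the power of
  -- `‖a‖`.
  refine ⟨C₁ * (R + 2) + C₀ * |p|, by positivity, fun x a ha => ?_⟩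
  have ha' : 0 < ‖a‖ := norm_pos_iff.2 ha
  rcases lt_or_ge R ‖a‖ with hRa | hRa
  · have : (fun q : V × E => singularKernel p Ξ q.1 q.2) =ᶠ[𝓝 (x, a)] fun _ => 0 := by
      have : ∀ᶠ q : V × E in 𝓝 (x, a), R < ‖q.2‖ :=
        (continuous_snd.norm.tendsto (x, a)).eventually (lt_mem_nhds hRa)
      filter_upwards [this] with q hq using hR' _ _ hq.le
    rw [this.fderiv_eq, fderiv_const_apply]
    exact (ContinuousLinearMap.opNorm_zero).le.trans (by positivity)
  obtain ⟨D, hD, hDn⟩ := hasFDerivAt_inv_norm_smul ha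
  obtain ⟨D', hD', hDn'⟩ := hasFDerivAt_norm_rpow_neg ha p
  have hsnd : HasFDerivAt (fun q : V × E => q.2) (ContinuousLinearMap.snd ℝ V E) (x, a) :=
    hasFDerivAt_snd
  have hsn : ‖ContinuousLinearMap.snd ℝ V E‖ ≤ 1 := ContinuousLinearMap.norm_snd_le ℝ V E
  have hfn : ‖ContinuousLinearMap.fst ℝ V E‖ ≤ 1 := ContinuousLinearMap.norm_fst_le ℝ V E
  obtain ⟨Du, hu, hun⟩ : ∃ Du : V × E →L[ℝ] E,
      HasFDerivAt (fun q : V × E => ‖q.2‖⁻¹ • q.2) Du (x, a) ∧ ‖Du‖ ≤ 2 * ‖a‖⁻¹ :=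
    ⟨_, hD.comp (g := fun a : E => ‖a‖⁻¹ • a) (x, a) hsnd, (ContinuousLinearMap.opNorm_comp_le _ _).trans
      ((mul_le_of_le_one_right (norm_nonneg _) hsn).trans hDn)⟩
  obtain ⟨Dr, hr, hrn⟩ : ∃ Dr : V × E →L[ℝ] ℝ,
      HasFDerivAt (fun q : V × E => ‖q.2‖ ^ (-p)) Dr (x, a) ∧ ‖Dr‖ ≤ |p| * ‖a‖ ^ (-p - 1) :=
    ⟨_, hD'.comp (g := fun a : E => ‖a‖ ^ (-p)) (x, a) hsnd, (ContinuousLinearMap.opNorm_comp_le _ _).trans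
      ((mul_le_of_le_one_right (norm_nonneg _) hsn).trans hDn')⟩
  obtain ⟨Dv, hv, hvn⟩ : ∃ Dv : V × E →L[ℝ] V × E × E,
      HasFDerivAt (fun q : V × E => (q.1, q.2, ‖q.2‖⁻¹ • q.2)) Dv (x, a) ∧
        ‖Dv‖ ≤ (R + 2) * ‖a‖⁻¹ := by
    refine ⟨_, (hasFDerivAt_fst (𝕜 := ℝ)).prodMk (hsnd.prodMk hu), ?_⟩
    have h1 : 1 ≤ R * ‖a‖⁻¹ := by
      rw [← div_eq_mul_inv, le_div_iff₀ ha']; linarith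
    have h2 : 0 < ‖a‖⁻¹ := by positivity
    have h3 : 0 < R * ‖a‖⁻¹ := by positivity
    rw [ContinuousLinearMap.opNorm_prod, Prod.norm_def, ContinuousLinearMap.opNorm_prod,
      Prod.norm_def]
    refine max_le ?_ (max_le ?_ ?_) <;> simp only [add_mul] <;> linarith
  obtain ⟨DΞ, hDΞ, hDΞn⟩ : ∃ DΞ : V × E →L[ℝ] ℝ,
      HasFDerivAt (fun q : V × E => Ξ (q.1, q.2, ‖q.2‖⁻¹ • q.2)) DΞ (x, a) ∧
        ‖DΞ‖ ≤ C₁ * ((R + 2) * ‖a‖⁻¹) := by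
    refine ⟨_, HasFDerivAt.comp (x, a)
      ((hΞ.differentiable one_ne_zero) (x, a, ‖a‖⁻¹ • a)).hasFDerivAt hv, ?_⟩
    exact (ContinuousLinearMap.opNorm_comp_le _ _).trans (by gcongr; exact hC₁ _)
  have hfin : HasFDerivAt (fun q : V × E => singularKernel p Ξ q.1 q.2)
      (‖a‖ ^ (-p) • DΞ + Ξ (x, a, ‖a‖⁻¹ • a) • Dr) (x, a) := hr.mul hDΞ
  rw [hfin.fderiv]
  have hpow : ‖a‖ ^ (-p - 1) = ‖a‖ ^ (-p) * ‖a‖⁻¹ := by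
    rw [Real.rpow_sub ha', Real.rpow_one, div_eq_mul_inv]
  refine (ContinuousLinearMap.opNorm_add_le _ _).trans ?_
  rw [add_mul]
  refine add_le_add ((ContinuousLinearMap.opNorm_smul_le _ _).trans ?_)
    ((ContinuousLinearMap.opNorm_smul_le _ _).trans ?_)
  rw [Real.norm_of_nonneg (by positivity : 0 ≤ ‖a‖ ^ (-p))]
  · calc _ ≤ ‖a‖ ^ (-p) * (C₁ * ((R + 2) * ‖a‖⁻¹)) := by gcongr
      _ = _ := by rw [hpow]; ring
  · calc _ ≤ C₀ * (|p| * ‖a‖ ^ (-p - 1)) := by gcongr; exact hC₀ _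
      _ = _ := by ring

end SingularKernel

/-! ### Differentiation of iterated integrals, one height at a time. -/

section Slices

variable {V W : Type*} [NormedAddCommGroup V] [NormedSpace ℝ V] [FiniteDimensional ℝ V]
  [MeasurableSpace V] [BorelSpace V] (μ : Measure V) [μ.IsAddHaarMeasure]
  [NormedAddCommGroup W] [NormedSpace ℝ W]

theorem aestronglyMeasurable_integral_slice {F : ℝ → V → W}
    (hF : ContinuousOn (fun q : ℝ × V => F q.1 q.2) {q | 0 < q.1}) :
    AEStronglyMeasurable (fun t => ∫ y, F t y ∂μ) (volume.restrict (Ioi 0)) := by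
  have h1 : ({q : ℝ × V | 0 < q.1}) = Ioi 0 ×ˢ univ := by ext; simp
  have h2 : AEStronglyMeasurable (fun q : ℝ × V => F q.1 q.2)
      ((volume.restrict (Ioi (0 : ℝ))).prod μ) := by
    rw [← Measure.restrict_univ (μ := μ), Measure.prod_restrict, ← h1]
    exact hF.aestronglyMeasurable (isOpen_lt continuous_const continuous_fst).measurableSet
  exact h2.integral_prod_right'

theorem integrable_of_bound_of_eq_zero {f : V → W} (hf : Continuous f) {x : V} {R C : ℝ}
    (hR : ∀ y, R ≤ ‖y - x‖ → f y = 0) (hC : ∀ y, ‖f y‖ ≤ C) : Integrable f μ := by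
  refine Integrable.mono' (g := (Metric.ball x R).indicator fun _ => C) ?_
    hf.aestronglyMeasurable (ae_of_all _ fun y => ?_)
  · rw [integrable_indicator_iff Metric.isOpen_ball.measurableSet]
    exact integrableOn_const Metric.isBounded_ball.measure_lt_top.ne
  · by_cases hy : y ∈ Metric.ball x R
    · simpa [hy] using hC y
    · simp [hy, hR y (by simpa [dist_eq_norm] using hy)]

/-- Translation invariance makes the bound independent of `x`, although the singularity moves with
`x`. -/
theorem norm_integral_slice_le [Nontrivial V] {f : V → W} {b₁ : V → ℝ} {c : ℝ} {x : V}
    (hb₁ : Integrable b₁ μ) (h : ∀ y, y ≠ x → ‖f y‖ ≤ b₁ (y - x) * c) :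
    ‖∫ y, f y ∂μ‖ ≤ (∫ y, b₁ y ∂μ) * c := by
  rw [← integral_sub_right_eq_self b₁ x, ← integral_mul_const]
  refine norm_integral_le_of_norm_le ((hb₁.comp_sub_right x).mul_const c) ?_
  filter_upwards [(measure_eq_zero_iff_ae_notMem.1 (measure_singleton (μ := μ) x))] with y hy
  exact h y hy

/-- Regularity of an iterated integral over a half-space, when each slice is regular in the
parameter and the derivatives are dominated by a translate of a product of integrable functions. -/
theorem contDiff_one_integral_slices [CompleteSpace W] [Nontrivial V] {G : V → V → ℝ → W}
    {G' : V → V → ℝ → V →L[ℝ] W} {R : ℝ} {b₁ : V → ℝ} {b₂ : ℝ → ℝ}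
    (hG : ContinuousOn (fun q : V × V × ℝ => G q.1 q.2.1 q.2.2) {q | 0 < q.2.2})
    (hG' : ContinuousOn (fun q : V × V × ℝ => G' q.1 q.2.1 q.2.2) {q | 0 < q.2.2})
    (hd : ∀ x y t, 0 < t → HasFDerivAt (fun x => G x y t) (G' x y t) x)
    (hR : ∀ x y t, 0 < t → R ≤ ‖y - x‖ → G x y t = 0 ∧ G' x y t = 0)
    (hC : ∀ t, 0 < t → ∃ C, ∀ x y, ‖G x y t‖ ≤ C ∧ ‖G' x y t‖ ≤ C)
    (hb₁ : Integrable b₁ μ) (hb₂ : IntegrableOn b₂ (Ioi 0))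
    (hb : ∀ x y t, 0 < t → y ≠ x → ‖G x y t‖ ≤ b₁ (y - x) * b₂ t ∧
      ‖G' x y t‖ ≤ b₁ (y - x) * b₂ t) :
    ContDiff ℝ 1 (fun x => ∫ t in Ioi 0, ∫ y, G x y t ∂μ) := by
  have hcG : ∀ x t, 0 < t → Continuous fun y => G x y t := fun x t ht =>
    hG.comp_continuous (f := fun y => (x, y, t)) (by fun_prop) (fun _ => ht)
  have hcG' : ∀ x t, 0 < t → Continuous fun y => G' x y t := fun x t ht =>
    hG'.comp_continuous (f := fun y => (x, y, t)) (by fun_prop) (fun _ => ht)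
  have hmG : ∀ x, AEStronglyMeasurable (fun t => ∫ y, G x y t ∂μ) (volume.restrict (Ioi 0)) :=
    fun x => aestronglyMeasurable_integral_slice μ (F := fun t y => G x y t)
      (hG.comp (f := fun q : ℝ × V => (x, q.2, q.1)) (by fun_prop) (fun q hq => hq))
  have hmG' : ∀ x, AEStronglyMeasurable (fun t => ∫ y, G' x y t ∂μ) (volume.restrict (Ioi 0)) :=
    fun x => aestronglyMeasurable_integral_slice μ (F := fun t y => G' x y t)
      (hG'.comp (f := fun q : ℝ × V => (x, q.2, q.1)) (by fun_prop) (fun q hq => hq))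
  -- Letting `x` range over a unit ball enlarges the common support of the slices by `1`.
  have hnear : ∀ x₀ x y : V, x ∈ Metric.ball x₀ 1 → R + 1 ≤ ‖y - x₀‖ → R ≤ ‖y - x‖ := by
    intro x₀ x y hx hy
    rw [mem_ball_iff_norm] at hx
    have : ‖y - x₀‖ ≤ ‖y - x‖ + ‖x - x₀‖ := by simpa using norm_add_le (y - x) (x - x₀)
    linarith
  have hdom : ∀ (C : ℝ) (x₀ : V),
      Integrable ((Metric.ball x₀ (R + 1)).indicator fun _ => C) μ := by
    intro C x₀
    rw [integrable_indicator_iff Metric.isOpen_ball.measurableSet]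
    exact integrableOn_const Metric.isBounded_ball.measure_lt_top.ne
  have hdom' : ∀ {t C : ℝ} {x₀ x : V}, 0 < t → (∀ x y, ‖G x y t‖ ≤ C ∧ ‖G' x y t‖ ≤ C) →
      x ∈ Metric.ball x₀ 1 → ∀ y,
      ‖G' x y t‖ ≤ (Metric.ball x₀ (R + 1)).indicator (fun _ => C) y := by
    intro t C x₀ x ht hCt hx y
    by_cases hy : y ∈ Metric.ball x₀ (R + 1)
    · simpa [hy] using (hCt x y).2
    · have := (hR x y t ht (hnear x₀ x y hx (by simpa [dist_eq_norm] using hy))).2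
      simp [hy, this]
  have hslice : ∀ t, 0 < t → ∀ x,
      HasFDerivAt (fun x => ∫ y, G x y t ∂μ) (∫ y, G' x y t ∂μ) x := by
    intro t ht x
    obtain ⟨C, hCt⟩ := hC t ht
    refine hasFDerivAt_integral_of_dominated_of_fderiv_le
      (bound := (Metric.ball x (R + 1)).indicator fun _ => C) (Metric.ball_mem_nhds x one_pos)
      (Eventually.of_forall fun x' => (hcG x' t ht).aestronglyMeasurable)
      (integrable_of_bound_of_eq_zero μ (hcG x t ht) (fun y hy => (hR x y t ht hy).1)
        (fun y => (hCt x y).1)) (hcG' x t ht).aestronglyMeasurable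
      (ae_of_all _ fun y x' hx' => hdom' ht hCt hx' y) (hdom C x)
      (ae_of_all _ fun y x' _ => hd x' y t ht)
  have hslicec : ∀ t, 0 < t → Continuous fun x => ∫ y, G' x y t ∂μ := by
    intro t ht
    obtain ⟨C, hCt⟩ := hC t ht
    rw [continuous_iff_continuousAt]
    intro x
    refine continuousAt_of_dominated
      (bound := (Metric.ball x (R + 1)).indicator fun _ => C)
      (Eventually.of_forall fun x' => (hcG' x' t ht).aestronglyMeasurable) ?_ (hdom C x)
      (ae_of_all _ fun y => ?_)
    · filter_upwards [Metric.ball_mem_nhds x one_pos] with x' hx'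
      exact ae_of_all _ fun y => hdom' ht hCt hx' y
    · exact (hG'.comp_continuous (f := fun x => (x, y, t)) (by fun_prop)
        (fun _ => ht)).continuousAt
  -- The majorant in `(y, t)` travels with `x`, so it cannot be used for dominated convergence
  -- directly. Integrating over `y` first leaves a majorant in `t` alone. At fixed `t > 0` nothing
  -- is singular and crude bounds sufficed.
  have hbd : ∀ t, 0 < t → ∀ x, ‖∫ y, G' x y t ∂μ‖ ≤ (∫ y, b₁ y ∂μ) * b₂ t := fun t ht x =>
    norm_integral_slice_le μ hb₁ fun y hy => (hb x y t ht hy).2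
  refine contDiff_one_iff_hasFDerivAt.2 ⟨fun x => ∫ t in Ioi 0, ∫ y, G' x y t ∂μ, ?_, fun x => ?_⟩
  · exact continuous_of_dominated hmG'
      (fun x => (ae_restrict_iff' measurableSet_Ioi).2 (ae_of_all _ fun t ht => hbd t ht x))
      (hb₂.const_mul _) ((ae_restrict_iff' measurableSet_Ioi).2 (ae_of_all _ hslicec))
  · refine hasFDerivAt_integral_of_dominated_of_fderiv_le (s := univ)
      (F := fun x t => ∫ y, G x y t ∂μ) (F' := fun x t => ∫ y, G' x y t ∂μ)
      (bound := fun t => (∫ y, b₁ y ∂μ) * b₂ t) univ_mem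
      (Eventually.of_forall hmG) ?_ (hmG' x) ?_ (hb₂.const_mul _) ?_
    · refine Integrable.mono' (hb₂.const_mul (∫ y, b₁ y ∂μ)) (hmG x)
        ((ae_restrict_iff' measurableSet_Ioi).2 (ae_of_all _ fun t ht => ?_))
      exact norm_integral_slice_le μ hb₁ fun y hy => (hb x y t ht hy).1
    · exact (ae_restrict_iff' measurableSet_Ioi).2 (ae_of_all _ fun t ht x _ => hbd t ht x)
    · exact (ae_restrict_iff' measurableSet_Ioi).2 (ae_of_all _ fun t ht x _ => hslice t ht x)

end Slices

/-! ### The integrable majorant. -/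

section Domination

variable {V E : Type*} [NormedAddCommGroup V] [NormedSpace ℝ V] [FiniteDimensional ℝ V]
  [MeasurableSpace V] [BorelSpace V] (μ : Measure V) [μ.IsAddHaarMeasure]
  [NormedAddCommGroup E] [NormedSpace ℝ E] (T : (V × ℝ) ≃L[ℝ] E)

theorem ContinuousLinearEquiv.exists_norm_le_mul : ∃ M, 0 < M ∧ ∀ w, ‖w‖ ≤ M * ‖T w‖ := by
  refine ⟨‖(T.symm : E →L[ℝ] V × ℝ)‖ + 1, by positivity, fun w => ?_⟩
  have := (T.symm : E →L[ℝ] V × ℝ).le_opNorm (T w)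
  simp only [ContinuousLinearEquiv.coe_coe, ContinuousLinearEquiv.symm_apply_apply] at this
  nlinarith [norm_nonneg (T w)]

theorem rpow_neg_le_of_le_mul {a b M α : ℝ} (hb : 0 < b) (hM : 0 < M) (h : b ≤ M * a)
    (hα : 0 ≤ α) : a ^ (-α) ≤ M ^ α * b ^ (-α) := by
  have h1 : b / M ≤ a := by rw [div_le_iff₀ hM]; linarith
  calc a ^ (-α) ≤ (b / M) ^ (-α) :=
        Real.rpow_le_rpow_of_nonpos (by positivity) h1 (by linarith)
    _ = M ^ α * b ^ (-α) := by
        rw [Real.div_rpow hb.le hM.le, Real.rpow_neg hM.le, div_inv_eq_mul, mul_comm]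

/-- Both `‖w‖` and `t` are at most a multiple of `‖T (w, t)‖`, so its negative power can be shared
between them. -/
theorem exists_dominating_product {s p : ℝ} (hs : 0 ≤ s) (hs' : s < 1)
    (hk : 1 ≤ Module.finrank ℝ V) (hp : p = Module.finrank ℝ V + 2 * s - 1) (R : ℝ) :
    ∃ (b₁ : V → ℝ) (b₂ : ℝ → ℝ), Integrable b₁ μ ∧ IntegrableOn b₂ (Ioi 0) ∧
      (∀ w, 0 ≤ b₁ w) ∧ (∀ t, 0 < t → 0 ≤ b₂ t) ∧
      ∀ w t, w ≠ 0 → 0 < t → ‖T (w, t)‖ < R →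
        t ^ s * ‖T (w, t)‖ ^ (-p - 1) ≤ b₁ w * b₂ t := by
  obtain ⟨M, hM, hT⟩ := T.exists_norm_le_mul
  set k : ℝ := (Module.finrank ℝ V : ℝ) with hk'
  have hk1 : 1 ≤ k := by rw [hk']; exact_mod_cast hk
  -- The exponent `k + 2 * s` is split as `(k - η) + (2 * s + η)`. The first share is integrable in
  -- `w` since `η > 0`. The second, weighted by `t ^ s`, leaves `t ^ (-s - η)`, with `-s - η = -(1 +
  -- s) / 2 > -1`.
  set η := (1 - s) / 2 with hη
  refine ⟨(Metric.ball 0 (M * R)).indicator fun w => M ^ (k - η) * ‖w‖ ^ (-(k - η)),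
    (Ioo 0 (M * R)).indicator fun t => M ^ (2 * s + η) * t ^ (-s - η), ?_, ?_, ?_, ?_, ?_⟩
  · rw [integrable_indicator_iff Metric.isOpen_ball.measurableSet]
    refine integrableOn_ball_of_norm_le_rpow (C := M ^ (k - η)) (α := k - η) hk
      (by rw [← hk']; linarith) (ae_of_all _ fun w => ?_) (Measurable.aestronglyMeasurable ?_)
    · rw [Real.norm_of_nonneg (by positivity)]
    · exact (measurable_norm.pow_const _).const_mul _
  · refine Integrable.integrableOn ?_
    rw [integrable_indicator_iff measurableSet_Ioo]
    refine Integrable.const_mul ?_ _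
    by_cases hR : 0 < M * R
    · exact (intervalIntegral.integrableOn_Ioo_rpow_iff hR).2 (by linarith)
    · simp [Ioo_eq_empty hR]
  · exact fun w => indicator_nonneg (fun _ _ => by positivity) w
  · exact fun t ht => indicator_nonneg (fun t ht => by have := ht.1; positivity) t
  · intro w t hw ht hR
    have hw' : 0 < ‖w‖ := norm_pos_iff.2 hw
    have h1 : ‖w‖ ≤ M * ‖T (w, t)‖ := (norm_fst_le (w, t)).trans (hT _)
    have h2 : t ≤ M * ‖T (w, t)‖ := (le_abs_self t).trans ((norm_snd_le (w, t)).trans (hT _))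
    have h3 : M * ‖T (w, t)‖ < M * R := by gcongr
    have ha : 0 < ‖T (w, t)‖ := by
      by_contra h
      have : ‖T (w, t)‖ = 0 := le_antisymm (not_lt.1 h) (norm_nonneg _)
      rw [this, mul_zero] at h2
      linarith
    rw [indicator_of_mem (by simpa using h1.trans_lt h3),
      indicator_of_mem (by exact ⟨ht, h2.trans_lt h3⟩)]
    have e1 := rpow_neg_le_of_le_mul hw' hM h1 (by linarith : 0 ≤ k - η)
    have e2 := rpow_neg_le_of_le_mul ht hM h2 (by linarith : 0 ≤ 2 * s + η)
    have e3 : ‖T (w, t)‖ ^ (-p - 1) = ‖T (w, t)‖ ^ (-(k - η)) * ‖T (w, t)‖ ^ (-(2 * s + η)) := by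
      rw [← Real.rpow_add ha, hp]; ring_nf
    have e4 : t ^ (-s - η) = t ^ s * t ^ (-(2 * s + η)) := by
      rw [← Real.rpow_add ht]; ring_nf
    calc _ ≤ t ^ s * ((M ^ (k - η) * ‖w‖ ^ (-(k - η))) *
          (M ^ (2 * s + η) * t ^ (-(2 * s + η)))) := by
          rw [e3]; gcongr
      _ = _ := by rw [e4]; ring

end Domination

/-! ### Functions with bounded tangential derivatives. -/

section TangentialCk

variable {V W : Type*} [NormedAddCommGroup V] [NormedSpace ℝ V]
  [NormedAddCommGroup W] [NormedSpace ℝ W]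

/-- `g` is continuous and bounded on `A ⊆ V × ℝ`, together with its iterated derivatives of order
at most `m` in the directions of `V`. -/
def TangentialCk (A : Set (V × ℝ)) : ℕ → (V × ℝ → W) → Prop
  | 0, g => ContinuousOn g A ∧ ∃ C, ∀ y ∈ A, ‖g y‖ ≤ C
  | m + 1, g => (ContinuousOn g A ∧ ∃ C, ∀ y ∈ A, ‖g y‖ ≤ C) ∧ ∃ g' : V × ℝ → V →L[ℝ] W,
      (∀ y ∈ A, HasFDerivAt (fun z => g (z, y.2)) (g' y) y.1) ∧
      (ContinuousOn g' A ∧ ∃ C, ∀ y ∈ A, ‖g' y‖ ≤ C) ∧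
      ∀ v, TangentialCk A m (fun y => g' y v)

theorem TangentialCk.zero {A : Set (V × ℝ)} {m : ℕ} {g : V × ℝ → W} (h : TangentialCk A m g) :
    TangentialCk A 0 g := by
  cases m with
  | zero => exact h
  | succ m => exact h.1

theorem TangentialCk.pred {A : Set (V × ℝ)} {m : ℕ} {g : V × ℝ → W}
    (h : TangentialCk A (m + 1) g) : TangentialCk A m g := by
  induction m generalizing g with
  | zero => exact h.zero
  | succ m ih =>
    obtain ⟨h0, g', hd, hg', hv⟩ := h
    exact ⟨h0, g', hd, hg', fun v => ih (hv v)⟩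

end TangentialCk

/-! ### Regularity of half-space potentials. -/

section HalfSpacePotential

variable {V E W : Type*} [NormedAddCommGroup V] [NormedSpace ℝ V] [FiniteDimensional ℝ V]
  [MeasurableSpace V] [BorelSpace V] (μ : Measure V) [μ.IsAddHaarMeasure]
  [NormedAddCommGroup E] [InnerProductSpace ℝ E] (T : (V × ℝ) ≃L[ℝ] E)
  [NormedAddCommGroup W] [NormedSpace ℝ W]

/-- The derivative in `(x, a)` of a singular kernel. -/
noncomputable def singularKernelFDeriv (p : ℝ) (Ξ : V × E × E → ℝ) (x : V) (a : E) :
    V × E →L[ℝ] ℝ :=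
  fderiv ℝ (fun q : V × E => singularKernel p Ξ q.1 q.2) (x, a)

/-- The integral over the half-space of `t ^ s` times a singular kernel, times a density
translated by the base point. -/
noncomputable def halfSpacePotential (s p : ℝ) (Ξ : V × E × E → ℝ) (g : V × ℝ → W) (x : V) : W :=
  ∫ w in {w : V × ℝ | 0 < w.2},
    (w.2 ^ s * singularKernel p Ξ x (T w)) • g (x + w.1, w.2) ∂(μ.prod volume)

theorem hasFDerivAt_singularKernel {p : ℝ} {Ξ : V × E × E → ℝ} (hΞ : ContDiff ℝ 1 Ξ) (x : V) {a : E}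
    (ha : a ≠ 0) : HasFDerivAt (fun q : V × E => singularKernel p Ξ q.1 q.2)
      (singularKernelFDeriv p Ξ x a) (x, a) := by
  refine (ContDiffAt.differentiableAt (n := 1) ?_ one_ne_zero).hasFDerivAt
  exact (contDiffOn_singularKernel hΞ).contDiffAt
    ((isOpen_ne_fun continuous_snd continuous_const).mem_nhds ha)

theorem continuousOn_singularKernel {p : ℝ} {Ξ : V × E × E → ℝ} (hΞ : ContDiff ℝ 1 Ξ) :
    ContinuousOn (fun q : V × E => singularKernel p Ξ q.1 q.2) {q | q.2 ≠ 0} :=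
  (contDiffOn_singularKernel hΞ).continuousOn

theorem continuousOn_singularKernelFDeriv {p : ℝ} {Ξ : V × E × E → ℝ} (hΞ : ContDiff ℝ 1 Ξ) :
    ContinuousOn (fun q : V × E => singularKernelFDeriv p Ξ q.1 q.2) {q | q.2 ≠ 0} :=
  (contDiffOn_singularKernel hΞ).continuousOn_fderiv_of_isOpen
    (isOpen_ne_fun continuous_snd continuous_const) le_rfl

theorem hasFDerivAt_singularKernel_left {p : ℝ} {Ξ : V × E × E → ℝ} (hΞ : ContDiff ℝ 1 Ξ) (x : V)
    {a : E} (ha : a ≠ 0) : HasFDerivAt (fun x => singularKernel p Ξ x a)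
      ((singularKernelFDeriv p Ξ x a).comp (ContinuousLinearMap.inl ℝ V E)) x :=
  (hasFDerivAt_singularKernel hΞ x ha).comp (f := fun x => (x, a)) x (hasFDerivAt_prodMk_left x a)

/-- A derivative in the base point only changes the profile; the order of the singularity stays
`-p`, which is what lets the induction on `m` run. -/
theorem singularKernelFDeriv_inl {p : ℝ} {Ξ : V × E × E → ℝ} (hΞ : ContDiff ℝ 1 Ξ) (x : V)
    {a : E} (ha : a ≠ 0) (v : V) : singularKernelFDeriv p Ξ x a (v, 0) =
      singularKernel p (fun q => fderiv ℝ Ξ q (v, 0, 0)) x a := by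
  have h1 : HasFDerivAt (fun x => Ξ (x, a, ‖a‖⁻¹ • a)) _ x :=
    ((hΞ.differentiable one_ne_zero) (x, a, ‖a‖⁻¹ • a)).hasFDerivAt.comp
      (f := fun x => (x, a, ‖a‖⁻¹ • a)) x (hasFDerivAt_prodMk_left x (a, ‖a‖⁻¹ • a))
  have h2 := (hasFDerivAt_singularKernel_left (p := p) hΞ x ha).unique (h1.const_mul (‖a‖ ^ (-p)))
  exact DFunLike.congr_fun h2 v

theorem exists_singularKernel_bounds {s p : ℝ} {Ξ : V × E × E → ℝ} (hs : 0 ≤ s) (hs' : s < 1)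
    (hk : 1 ≤ Module.finrank ℝ V) (hp : p = Module.finrank ℝ V + 2 * s - 1)
    (hΞ : ContDiff ℝ 1 Ξ) (hc : HasCompactSupport Ξ) :
    ∃ (R : ℝ) (b₁ : V → ℝ) (b₂ : ℝ → ℝ), Integrable b₁ μ ∧ IntegrableOn b₂ (Ioi 0) ∧
      (∀ w, 0 ≤ b₁ w) ∧ (∀ t, 0 < t → 0 ≤ b₂ t) ∧
      (∀ x w t, R ≤ ‖w‖ → singularKernel p Ξ x (T (w, t)) = 0 ∧
        singularKernelFDeriv p Ξ x (T (w, t)) = 0) ∧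
      (∀ t, 0 < t → ∃ C, 0 ≤ C ∧ ∀ x w, ‖singularKernel p Ξ x (T (w, t))‖ ≤ C ∧
        ‖singularKernelFDeriv p Ξ x (T (w, t))‖ ≤ C) ∧
      ∀ x w t, w ≠ 0 → 0 < t → t ^ s * ‖singularKernel p Ξ x (T (w, t))‖ ≤ b₁ w * b₂ t ∧
        t ^ s * ‖singularKernelFDeriv p Ξ x (T (w, t))‖ ≤ b₁ w * b₂ t := by
  obtain ⟨C₀, hC₀, hK⟩ := exists_norm_singularKernel_le (p := p) hΞ.continuous hc
  obtain ⟨C₁, hC₁, hK'⟩ := exists_norm_fderiv_singularKernel_le (p := p) hΞ hc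
  obtain ⟨R, hR, hRK⟩ := exists_singularKernel_eq_zero (p := p) hc
  obtain ⟨M, hM, hT⟩ := T.exists_norm_le_mul
  -- The majorant is only valid for norms strictly below its radius, while the kernel's derivative
  -- is known to vanish only strictly beyond `R`; hence `R + 1`.
  obtain ⟨b₁, b₂, hb₁, hb₂, hb₁0, hb₂0, hb⟩ := exists_dominating_product μ T hs hs' hk hp (R + 1)
  have hRK' : ∀ x a, R < ‖a‖ → singularKernelFDeriv p Ξ x a = 0 := by
    intro x a ha
    have : (fun q : V × E => singularKernel p Ξ q.1 q.2) =ᶠ[𝓝 (x, a)] fun _ => 0 := by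
      have : ∀ᶠ q : V × E in 𝓝 (x, a), R < ‖q.2‖ :=
        (continuous_snd.norm.tendsto (x, a)).eventually (lt_mem_nhds ha)
      filter_upwards [this] with q hq using hRK _ _ hq.le
    rw [singularKernelFDeriv, this.fderiv_eq, fderiv_const_apply]
  have hne : ∀ w t, 0 < t → T (w, t) ≠ 0 := by
    intro w t ht h
    rw [ContinuousLinearEquiv.map_eq_zero_iff] at h
    exact ht.ne' (congrArg Prod.snd h)
  -- Inside its support the kernel also obeys the weaker bound of its derivative, so a single
  -- majorant serves both.
  have hKR : ∀ x a, a ≠ 0 → ‖singularKernel p Ξ x a‖ ≤ (C₀ * R) * ‖a‖ ^ (-p - 1) := by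
    intro x a ha
    have ha' : 0 < ‖a‖ := norm_pos_iff.2 ha
    rcases le_or_gt R ‖a‖ with h | h
    · rw [hRK x a h, norm_zero]; positivity
    · refine (hK x a).trans ?_
      rw [mul_assoc, Real.rpow_sub ha', Real.rpow_one, mul_div_assoc']
      gcongr
      rw [le_div_iff₀ ha', mul_comm]
      gcongr
  have hp1 : 0 ≤ p + 1 := by rw [hp, sub_add_cancel]; positivity
  set C := C₀ * R + C₁ with hC
  have hC0 : 0 ≤ C := by positivity
  have hKC : ∀ x a, a ≠ 0 → ‖singularKernel p Ξ x a‖ ≤ C * ‖a‖ ^ (-p - 1) := fun x a ha =>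
    (hKR x a ha).trans (by gcongr; linarith)
  have hKC' : ∀ x a, a ≠ 0 → ‖singularKernelFDeriv p Ξ x a‖ ≤ C * ‖a‖ ^ (-p - 1) := fun x a ha =>
    (hK' x a ha).trans (by gcongr; nlinarith)
  refine ⟨M * (R + 1), fun w => C * b₁ w, b₂, hb₁.const_mul C, hb₂,
    fun w => mul_nonneg hC0 (hb₁0 w), hb₂0, ?_, ?_, ?_⟩
  · intro x w t hw
    have h1 : R + 1 ≤ ‖T (w, t)‖ := by
      have := (norm_fst_le (w, t)).trans (hT _)
      exact le_of_mul_le_mul_left (hw.trans this) hM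
    exact ⟨hRK _ _ (by linarith), hRK' _ _ (by linarith)⟩
  · intro t ht
    refine ⟨C * (M ^ (p + 1) * t ^ (-(p + 1))), by positivity, fun x w => ?_⟩
    have h2 : t ≤ M * ‖T (w, t)‖ := (le_abs_self t).trans ((norm_snd_le (w, t)).trans (hT _))
    have h3 := rpow_neg_le_of_le_mul ht hM h2 hp1
    rw [neg_add'] at h3
    rw [neg_add']
    exact ⟨(hKC x _ (hne w t ht)).trans (by gcongr), (hKC' x _ (hne w t ht)).trans (by gcongr)⟩
  · intro x w t hw ht
    have key : ∀ r : ℝ, (R < ‖T (w, t)‖ → r = 0) → r ≤ C * ‖T (w, t)‖ ^ (-p - 1) →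
        t ^ s * r ≤ C * b₁ w * b₂ t := by
      intro r h1 h2
      rcases lt_or_ge R ‖T (w, t)‖ with h | h
      · rw [h1 h, mul_zero]
        exact mul_nonneg (mul_nonneg hC0 (hb₁0 w)) (hb₂0 t ht)
      · calc t ^ s * r ≤ t ^ s * (C * ‖T (w, t)‖ ^ (-p - 1)) := by gcongr
          _ = C * (t ^ s * ‖T (w, t)‖ ^ (-p - 1)) := by ring
          _ ≤ C * (b₁ w * b₂ t) := mul_le_mul_of_nonneg_left (hb w t hw ht (by linarith)) hC0
          _ = _ := by ring
    exact ⟨key _ (fun h => by rw [hRK _ _ h.le, norm_zero]) (hKC x _ (hne w t ht)),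
      key _ (fun h => by rw [hRK' _ _ h]; exact ContinuousLinearMap.opNorm_zero)
        (hKC' x _ (hne w t ht))⟩

theorem restrict_halfSpace_eq_prod :
    (μ.prod (volume : Measure ℝ)).restrict {w | 0 < w.2} = μ.prod (volume.restrict (Ioi 0)) := by
  have h1 : ({w : V × ℝ | 0 < w.2}) = univ ×ˢ Ioi 0 := by ext; simp
  rw [h1, ← Measure.prod_restrict, Measure.restrict_univ]

theorem integrableOn_halfSpace_of_le [Nontrivial V] {h : V × ℝ → W} {b₁ : V → ℝ} {b₂ : ℝ → ℝ}
    (hb₁ : Integrable b₁ μ) (hb₂ : IntegrableOn b₂ (Ioi 0))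
    (hc : ContinuousOn h {w : V × ℝ | 0 < w.2})
    (hb : ∀ w t, w ≠ 0 → 0 < t → ‖h (w, t)‖ ≤ b₁ w * b₂ t) :
    IntegrableOn h {w : V × ℝ | 0 < w.2} (μ.prod volume) := by
  have hm : MeasurableSet {w : V × ℝ | 0 < w.2} :=
    (isOpen_lt continuous_const continuous_snd).measurableSet
  have hi : IntegrableOn (fun w : V × ℝ => b₁ w.1 * b₂ w.2) {w : V × ℝ | 0 < w.2}
      (μ.prod volume) := by
    rw [IntegrableOn, restrict_halfSpace_eq_prod]
    exact hb₁.mul_prod hb₂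
  refine Integrable.mono' hi (hc.aestronglyMeasurable hm) ?_
  have h0 : ∀ᵐ w : V × ℝ ∂(μ.prod volume), w.1 ≠ 0 :=
    Measure.quasiMeasurePreserving_fst.ae
      (measure_eq_zero_iff_ae_notMem.1 (measure_singleton (μ := μ) 0))
  filter_upwards [ae_restrict_of_ae h0, ae_restrict_mem hm] with w hw ht
  exact hb w.1 w.2 hw ht

theorem map_ne_zero_of_pos_snd {w : V × ℝ} (hw : 0 < w.2) : T w ≠ 0 := by
  rw [Ne, ContinuousLinearEquiv.map_eq_zero_iff]
  rintro rfl
  simp at hw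

theorem continuousOn_halfSpacePotential_integrand {s p : ℝ} {Ξ : V × E × E → ℝ}
    (hΞ : ContDiff ℝ 1 Ξ) {g : V × ℝ → W} (hg : ContinuousOn g {w | 0 < w.2}) (x : V) :
    ContinuousOn (fun w : V × ℝ => (w.2 ^ s * singularKernel p Ξ x (T w)) • g (x + w.1, w.2))
      {w | 0 < w.2} := by
  refine ContinuousOn.smul (ContinuousOn.mul ?_ ?_) ?_
  · exact continuousOn_snd.rpow_const fun w hw => Or.inl (ne_of_gt hw)
  · exact (continuousOn_singularKernel hΞ).comp (f := fun w : V × ℝ => (x, T w)) (by fun_prop)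
      fun w hw => map_ne_zero_of_pos_snd T hw
  · exact hg.comp (f := fun w : V × ℝ => (x + w.1, w.2)) (by fun_prop) fun w hw => hw

theorem integrableOn_halfSpacePotential [Nontrivial V] {s p : ℝ} {Ξ : V × E × E → ℝ}
    (hs : 0 ≤ s) (hs' : s < 1) (hp : p = Module.finrank ℝ V + 2 * s - 1)
    (hΞ : ContDiff ℝ 1 Ξ) (hc : HasCompactSupport Ξ) {g : V × ℝ → W}
    (hg : TangentialCk {w | 0 < w.2} 0 g) (x : V) :
    IntegrableOn (fun w : V × ℝ => (w.2 ^ s * singularKernel p Ξ x (T w)) • g (x + w.1, w.2))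
      {w | 0 < w.2} (μ.prod volume) := by
  obtain ⟨hg, C, hC⟩ := hg
  obtain ⟨R, b₁, b₂, hb₁, hb₂, hb₁0, hb₂0, -, -, hb⟩ :=
    exists_singularKernel_bounds μ T hs hs' Module.finrank_pos hp hΞ hc
  refine integrableOn_halfSpace_of_le μ (hb₁.const_mul |C|) hb₂
    (continuousOn_halfSpacePotential_integrand T hΞ hg x) fun w t hw ht => ?_
  rw [norm_smul, norm_mul, Real.norm_of_nonneg (by positivity : 0 ≤ t ^ s)]
  calc _ ≤ b₁ w * b₂ t * |C| := by
        have h1 := (hb x w t hw ht).1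
        have h2 := (hC (x + w, t) ht).trans (le_abs_self C)
        exact mul_le_mul h1 h2 (norm_nonneg _) (mul_nonneg (hb₁0 w) (hb₂0 t ht))
    _ = _ := by ring

/-- This is the gain of one derivative: no derivative of `g` is assumed, since all of it falls on
the kernel. -/
theorem contDiff_one_halfSpacePotential [CompleteSpace W] [Nontrivial V] {s p : ℝ}
    {Ξ : V × E × E → ℝ} (hs : 0 ≤ s) (hs' : s < 1)
    (hp : p = Module.finrank ℝ V + 2 * s - 1)
    (hΞ : ContDiff ℝ 1 Ξ) (hc : HasCompactSupport Ξ) {g : V × ℝ → W}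
    (hg : TangentialCk {w | 0 < w.2} 0 g) :
    ContDiff ℝ 1 (halfSpacePotential μ T s p Ξ g) := by
  have hint := integrableOn_halfSpacePotential μ T hs hs' hp hΞ hc hg
  obtain ⟨hg, C, hC⟩ := hg
  obtain ⟨R, b₁, b₂, hb₁, hb₂, hb₁0, hb₂0, hR, hS, hb⟩ :=
    exists_singularKernel_bounds μ T hs hs' Module.finrank_pos hp hΞ hc
  have hne : ∀ {w t}, 0 < t → T (w, t) ≠ 0 := fun ht => map_ne_zero_of_pos_snd T ht
  -- The derivative of `x ↦ (x, T (y - x, t))`.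
  let L : V →L[ℝ] V × E :=
    (ContinuousLinearMap.id ℝ V).prod
      (-((T : V × ℝ →L[ℝ] E).comp (ContinuousLinearMap.inl ℝ V ℝ)))
  -- The substitution `y = x + w` moves all dependence on `x` from the density to the kernel.
  have hunshift : halfSpacePotential μ T s p Ξ g = fun x => ∫ t in Ioi 0, ∫ y,
      (t ^ s * singularKernel p Ξ x (T (y - x, t))) • g (y, t) ∂μ := by
    funext x
    have h1 := hint x
    rw [IntegrableOn, restrict_halfSpace_eq_prod] at h1
    rw [halfSpacePotential, restrict_halfSpace_eq_prod, integral_prod_symm _ h1]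
    refine integral_congr_ae (ae_of_all _ fun t => ?_)
    beta_reduce
    rw [← integral_add_left_eq_self (μ := μ)
      (fun y => (t ^ s * singularKernel p Ξ x (T (y - x, t))) • g (y, t)) x]
    simp
  rw [hunshift]
  have hcg : ContinuousOn (fun q : V × V × ℝ => g (q.2.1, q.2.2)) {q | 0 < q.2.2} :=
    hg.comp (f := fun q : V × V × ℝ => (q.2.1, q.2.2)) (by fun_prop) fun q hq => hq
  have hct : ContinuousOn (fun q : V × V × ℝ => q.2.2 ^ s) {q | 0 < q.2.2} :=
    ContinuousOn.rpow_const (by fun_prop) fun w hw => Or.inl (ne_of_gt hw)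
  refine contDiff_one_integral_slices (R := R) (b₁ := fun w => (|C| * (1 + ‖L‖)) * b₁ w) (b₂ := b₂) μ
    (G' := fun x y t => (t ^ s • (singularKernelFDeriv p Ξ x (T (y - x, t))).comp L).smulRight
      (g (y, t))) ?_ ?_ ?_ ?_ ?_ (hb₁.const_mul _) hb₂ ?_
  · refine ContinuousOn.smul (hct.mul ?_) hcg
    exact (continuousOn_singularKernel hΞ).comp
      (f := fun q : V × V × ℝ => (q.1, T (q.2.1 - q.1, q.2.2))) (by fun_prop) fun w hw => hne hw
  · have h1 : ContinuousOn (fun q : V × V × ℝ =>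
        singularKernelFDeriv p Ξ q.1 (T (q.2.1 - q.1, q.2.2))) {q | 0 < q.2.2} :=
      (continuousOn_singularKernelFDeriv hΞ).comp
        (f := fun q : V × V × ℝ => (q.1, T (q.2.1 - q.1, q.2.2))) (by fun_prop) fun w hw => hne hw
    have h2 := hct.smul (h1.clm_comp (continuousOn_const (c := L)))
    exact (((ContinuousLinearMap.smulRightL ℝ V W).isBoundedBilinearMap).continuous).comp_continuousOn
      (h2.prodMk hcg)
  · intro x y t ht
    have h1 : HasFDerivAt (fun x => (x, T (y - x, t))) L x := by
      have h2 : HasFDerivAt (fun x : V => (y - x, t)) (-(ContinuousLinearMap.inl ℝ V ℝ)) x := by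
        have := ((hasFDerivAt_id (𝕜 := ℝ) x).const_sub y).prodMk (hasFDerivAt_const (𝕜 := ℝ) t x)
        refine this.congr_fderiv ?_
        ext v <;> simp
      have := (hasFDerivAt_id (𝕜 := ℝ) x).prodMk
        ((T : V × ℝ →L[ℝ] E).hasFDerivAt.comp x h2)
      refine this.congr_fderiv ?_
      simp [L]
    have h3 := ((hasFDerivAt_singularKernel (p := p) hΞ x (hne ht)).comp (𝕜 := ℝ)
      (g := fun q : V × E => singularKernel p Ξ q.1 q.2) (f := fun x => (x, T (y - x, t))) x h1)
    exact (h3.const_mul (t ^ s)).smul_const (g (y, t))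
  · intro x y t ht h
    obtain ⟨h1, h2⟩ := hR x (y - x) t h
    constructor
    · simp [h1]
    · rw [h2]; ext; simp
  · intro t ht
    obtain ⟨B, hB0, hB⟩ := hS t ht
    refine ⟨t ^ s * B * |C| * (1 + ‖L‖), fun x y => ?_⟩
    have hgC := (hC (y, t) ht).trans (le_abs_self C)
    obtain ⟨h1, h2⟩ := hB x (y - x)
    have hL := norm_nonneg L
    constructor
    · rw [norm_smul, norm_mul, Real.norm_of_nonneg (by positivity : 0 ≤ t ^ s)]
      calc _ ≤ t ^ s * B * |C| := by gcongr
        _ ≤ _ := le_mul_of_one_le_right (by positivity) (by linarith)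
    · rw [ContinuousLinearMap.norm_smulRight_apply, norm_smul,
        Real.norm_of_nonneg (by positivity : 0 ≤ t ^ s)]
      calc _ ≤ t ^ s * (B * ‖L‖) * |C| := by
            gcongr
            exact (ContinuousLinearMap.opNorm_comp_le _ _).trans (by gcongr)
        _ = t ^ s * B * |C| * ‖L‖ := by ring
        _ ≤ _ := by gcongr; linarith
  · intro x y t ht hxy
    have hgC := (hC (y, t) ht).trans (le_abs_self C)
    obtain ⟨h1, h2⟩ := hb x (y - x) t (sub_ne_zero.2 hxy) ht
    have hL := norm_nonneg L
    have hbb : 0 ≤ b₁ (y - x) * b₂ t := mul_nonneg (hb₁0 _) (hb₂0 t ht)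
    constructor
    · rw [norm_smul, norm_mul, Real.norm_of_nonneg (by positivity : 0 ≤ t ^ s)]
      calc _ ≤ b₁ (y - x) * b₂ t * |C| := by gcongr
        _ ≤ b₁ (y - x) * b₂ t * |C| * (1 + ‖L‖) :=
          le_mul_of_one_le_right (by positivity) (by linarith)
        _ = _ := by ring
    · rw [ContinuousLinearMap.norm_smulRight_apply, norm_smul,
        Real.norm_of_nonneg (by positivity : 0 ≤ t ^ s)]
      calc _ ≤ t ^ s * (‖singularKernelFDeriv p Ξ x (T (y - x, t))‖ * ‖L‖) * |C| := by
            gcongr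
            exact ContinuousLinearMap.opNorm_comp_le _ _
        _ = t ^ s * ‖singularKernelFDeriv p Ξ x (T (y - x, t))‖ * ‖L‖ * |C| := by ring
        _ ≤ b₁ (y - x) * b₂ t * (1 + ‖L‖) * |C| := by gcongr; linarith
        _ = _ := by ring

/-- Here the translated form is kept: the singularity stays at `w = 0`, so one majorant dominates
for all `x` at once. The derivative is a sum of two potentials with kernels of unchanged order. -/
theorem hasFDerivAt_halfSpacePotential [CompleteSpace W] [Nontrivial V] {s p : ℝ}
    {Ξ : V × E × E → ℝ} (hs : 0 ≤ s) (hs' : s < 1)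
    (hp : p = Module.finrank ℝ V + 2 * s - 1)
    (hΞ : ContDiff ℝ 1 Ξ) (hc : HasCompactSupport Ξ) {g : V × ℝ → W} {g' : V × ℝ → V →L[ℝ] W}
    (hg : TangentialCk {w | 0 < w.2} 0 g)
    (hd : ∀ y ∈ {w : V × ℝ | 0 < w.2}, HasFDerivAt (fun z => g (z, y.2)) (g' y) y.1)
    (hg' : TangentialCk {w | 0 < w.2} 0 g') (x : V) :
    ∃ D : V →L[ℝ] W, HasFDerivAt (halfSpacePotential μ T s p Ξ g) D x ∧
      ∀ v, D v = ∫ w in {w : V × ℝ | 0 < w.2},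
        ((w.2 ^ s * singularKernel p Ξ x (T w)) • g' (x + w.1, w.2) v +
        (w.2 ^ s * singularKernel p (fun q => fderiv ℝ Ξ q (v, 0, 0)) x (T w)) •
          g (x + w.1, w.2)) ∂(μ.prod volume) := by
  have hint := integrableOn_halfSpacePotential μ T hs hs' hp hΞ hc hg
  obtain ⟨hgc, C, hC⟩ := hg
  obtain ⟨hgc', C', hC'⟩ := hg'
  obtain ⟨R, b₁, b₂, hb₁, hb₂, hb₁0, hb₂0, -, -, hb⟩ :=
    exists_singularKernel_bounds μ T hs hs' Module.finrank_pos hp hΞ hc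
  have hm : MeasurableSet {w : V × ℝ | 0 < w.2} :=
    (isOpen_lt continuous_const continuous_snd).measurableSet
  let D : V → V × ℝ → V →L[ℝ] W := fun x w =>
    (w.2 ^ s * singularKernel p Ξ x (T w)) • g' (x + w.1, w.2) +
      (w.2 ^ s • (singularKernelFDeriv p Ξ x (T w)).comp
        (ContinuousLinearMap.inl ℝ V E)).smulRight (g (x + w.1, w.2))
  have hDc : ContinuousOn (D x) {w | 0 < w.2} := by
    refine (continuousOn_halfSpacePotential_integrand T hΞ hgc' x).add ?_
    have h1 : ContinuousOn (fun w : V × ℝ => singularKernelFDeriv p Ξ x (T w)) {w | 0 < w.2} :=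
      (continuousOn_singularKernelFDeriv hΞ).comp (f := fun w : V × ℝ => (x, T w)) (by fun_prop)
        fun w hw => map_ne_zero_of_pos_snd T hw
    have h2 : ContinuousOn (fun w : V × ℝ => g (x + w.1, w.2)) {w | 0 < w.2} :=
      hgc.comp (f := fun w : V × ℝ => (x + w.1, w.2)) (by fun_prop) fun w hw => hw
    have h3 : ContinuousOn (fun w : V × ℝ => w.2 ^ s) {w | 0 < w.2} :=
      continuousOn_snd.rpow_const fun w hw => Or.inl (ne_of_gt hw)
    have h4 := h3.smul (h1.clm_comp (continuousOn_const (c := ContinuousLinearMap.inl ℝ V E)))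
    exact (((ContinuousLinearMap.smulRightL ℝ V W).isBoundedBilinearMap).continuous).comp_continuousOn
      (h4.prodMk h2)
  have hDb : ∀ x w t, w ≠ 0 → 0 < t → ‖D x (w, t)‖ ≤ (|C| + |C'|) * b₁ w * b₂ t := by
    intro x w t hw ht
    have e1 := (hC (x + w, t) ht).trans (le_abs_self C)
    have e2 := (hC' (x + w, t) ht).trans (le_abs_self C')
    obtain ⟨h1, h2⟩ := hb x w t hw ht
    have hbb : 0 ≤ b₁ w * b₂ t := mul_nonneg (hb₁0 _) (hb₂0 t ht)
    have ht' : 0 ≤ t ^ s := by positivity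
    refine (norm_add_le _ _).trans ?_
    rw [norm_smul, norm_mul, ContinuousLinearMap.norm_smulRight_apply, norm_smul,
      Real.norm_of_nonneg ht']
    have hinl : ‖(singularKernelFDeriv p Ξ x (T (w, t))).comp (ContinuousLinearMap.inl ℝ V E)‖ ≤
        ‖singularKernelFDeriv p Ξ x (T (w, t))‖ :=
      (ContinuousLinearMap.opNorm_comp_le _ _).trans
        (mul_le_of_le_one_right (norm_nonneg _) (ContinuousLinearMap.norm_inl_le_one ℝ V E))
    calc _ ≤ b₁ w * b₂ t * |C'| +
          t ^ s * ‖singularKernelFDeriv p Ξ x (T (w, t))‖ * |C| := by gcongr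
      _ ≤ b₁ w * b₂ t * |C'| + b₁ w * b₂ t * |C| := by gcongr
      _ = _ := by ring
  have hDi : Integrable (D x) ((μ.prod volume).restrict {w | 0 < w.2}) :=
    integrableOn_halfSpace_of_le μ (hb₁.const_mul _) hb₂ hDc (hDb x)
  have h0 : ∀ᵐ w : V × ℝ ∂(μ.prod volume), w.1 ≠ 0 :=
    Measure.quasiMeasurePreserving_fst.ae
      (measure_eq_zero_iff_ae_notMem.1 (measure_singleton (μ := μ) 0))
  refine ⟨∫ w in {w : V × ℝ | 0 < w.2}, D x w ∂(μ.prod volume), ?_, fun v => ?_⟩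
  · refine hasFDerivAt_integral_of_dominated_of_fderiv_le (s := univ)
      (F := fun x w => (w.2 ^ s * singularKernel p Ξ x (T w)) • g (x + w.1, w.2)) (F' := D)
      (bound := fun w => (|C| + |C'|) * b₁ w.1 * b₂ w.2) univ_mem
      (Eventually.of_forall fun x =>
        (continuousOn_halfSpacePotential_integrand T hΞ hgc x).aestronglyMeasurable hm) (hint x)
      hDi.aestronglyMeasurable ?_ ?_ ?_
    · filter_upwards [ae_restrict_of_ae h0, ae_restrict_mem hm] with w hw ht x _
      exact hDb x w.1 w.2 hw ht
    · rw [restrict_halfSpace_eq_prod]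
      exact (hb₁.const_mul _).mul_prod hb₂
    · filter_upwards [ae_restrict_mem hm] with w ht x _
      have h1 := (hasFDerivAt_singularKernel_left (p := p) hΞ x
        (map_ne_zero_of_pos_snd T ht)).const_mul (w.2 ^ s)
      have h2 : HasFDerivAt (fun x => g (x + w.1, w.2)) (g' (x + w.1, w.2)) x := by
        have h3 : HasFDerivAt (fun z => g (z, w.2)) (g' (x + w.1, w.2)) (x + w.1) :=
          hd (x + w.1, w.2) ht
        exact (hasFDerivAt_comp_add_right w.1).2 h3
      exact h1.smul h2
  · rw [ContinuousLinearMap.integral_apply hDi]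
    refine setIntegral_congr_fun hm fun w hw => ?_
    have := singularKernelFDeriv_inl (p := p) hΞ x (map_ne_zero_of_pos_snd T hw) v
    simp [D, this]

theorem contDiff_halfSpacePotential [CompleteSpace W] [Nontrivial V] {s p : ℝ}
    (hs : 0 ≤ s) (hs' : s < 1) (hp : p = Module.finrank ℝ V + 2 * s - 1) (m : ℕ)
    {Ξ : V × E × E → ℝ} (hΞ : ContDiff ℝ (m + 1) Ξ) (hc : HasCompactSupport Ξ) {g : V × ℝ → W}
    (hg : TangentialCk {w | 0 < w.2} m g) :
    ContDiff ℝ (m + 1) (halfSpacePotential μ T s p Ξ g) := by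
  induction m generalizing Ξ g with
  | zero => simpa using contDiff_one_halfSpacePotential μ T hs hs' hp (by simpa using hΞ) hc hg
  | succ m ih =>
    have hΞ1 : ContDiff ℝ 1 Ξ := hΞ.of_le (by exact_mod_cast Nat.le_add_left 1 (m + 1))
    obtain ⟨hg0, g', hd, hg0', hg'⟩ := id hg
    choose D hD hDv using
      hasFDerivAt_halfSpacePotential μ T hs hs' hp hΞ1 hc hg0 hd hg0'
    refine contDiff_succ_iff_fderiv_apply.2 ⟨fun x => (hD x).differentiableAt, ?_, fun v => ?_⟩
    · intro h
      exact absurd h (by exact_mod_cast WithTop.coe_ne_top)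
    · have hΞv : ContDiff ℝ (m + 1) fun q => fderiv ℝ Ξ q (v, 0, 0) :=
        (hΞ.fderiv_right (by push_cast; exact le_rfl)).clm_apply contDiff_const
      have hcv : HasCompactSupport fun q => fderiv ℝ Ξ q (v, 0, 0) := hc.fderiv_apply (𝕜 := ℝ) _
      have hΞv1 : ContDiff ℝ 1 fun q => fderiv ℝ Ξ q (v, 0, 0) :=
        hΞv.of_le (by exact_mod_cast Nat.le_add_left 1 m)
      have hΞ' : ContDiff ℝ (m + 1) Ξ :=
        hΞ.of_le (by exact_mod_cast Nat.le_succ (m + 1))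
      have hsum : (fun x => fderiv ℝ (halfSpacePotential μ T s p Ξ g) x v) =
          fun x => halfSpacePotential μ T s p Ξ (fun y => g' y v) x +
            halfSpacePotential μ T s p (fun q => fderiv ℝ Ξ q (v, 0, 0)) g x := by
        funext x
        rw [(hD x).fderiv, hDv]
        exact integral_add (integrableOn_halfSpacePotential μ T hs hs' hp hΞ1 hc (hg' v).zero x)
          (integrableOn_halfSpacePotential μ T hs hs' hp hΞv1 hcv hg0 x)
      rw [hsum]
      push_cast
      -- The first term spends one derivative of `g`, the second one derivative of `Ξ`. The one left
      -- over on `Ξ` serves the base case.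
      exact (ih hΞ' hc (hg' v)).add (ih hΞv hcv hg.pred)

end HalfSpacePotential

/-! ### Calculus of tangential regularity: products, powers, extension by zero, division by the
height. -/

section TangentialCk

variable {V W : Type*} [NormedAddCommGroup V] [NormedSpace ℝ V]
  [NormedAddCommGroup W] [NormedSpace ℝ W] {A : Set (V × ℝ)} {m : ℕ}

theorem TangentialCk.zero_add {g h : V × ℝ → W} (hg : TangentialCk A 0 g)
    (hh : TangentialCk A 0 h) : TangentialCk A 0 (fun y => g y + h y) := by
  obtain ⟨hg, C, hC⟩ := hg
  obtain ⟨hh, C', hC'⟩ := hh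
  exact ⟨hg.add hh, C + C', fun y hy => (norm_add_le _ _).trans (add_le_add (hC y hy) (hC' y hy))⟩

theorem TangentialCk.zero_smul {u : V × ℝ → ℝ} {g : V × ℝ → W} (hu : TangentialCk A 0 u)
    (hg : TangentialCk A 0 g) : TangentialCk A 0 (fun y => u y • g y) := by
  obtain ⟨hu, C, hC⟩ := hu
  obtain ⟨hg, C', hC'⟩ := hg
  refine ⟨hu.smul hg, C * C', fun y hy => ?_⟩
  rw [norm_smul]
  exact mul_le_mul (hC y hy) (hC' y hy) (norm_nonneg _) ((norm_nonneg _).trans (hC y hy))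

theorem TangentialCk.zero_smulRight {u : V × ℝ → V →L[ℝ] ℝ} {g : V × ℝ → W}
    (hu : TangentialCk A 0 u) (hg : TangentialCk A 0 g) :
    TangentialCk A 0 (fun y => (u y).smulRight (g y)) := by
  obtain ⟨hu, C, hC⟩ := hu
  obtain ⟨hg, C', hC'⟩ := hg
  refine ⟨(((ContinuousLinearMap.smulRightL ℝ V W).isBoundedBilinearMap).continuous).comp_continuousOn
      (hu.prodMk hg), C * C', fun y hy => ?_⟩
  rw [ContinuousLinearMap.norm_smulRight_apply]
  exact mul_le_mul (hC y hy) (hC' y hy) (norm_nonneg _) ((norm_nonneg _).trans (hC y hy))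

theorem TangentialCk.add {g h : V × ℝ → W} (hg : TangentialCk A m g)
    (hh : TangentialCk A m h) : TangentialCk A m (fun y => g y + h y) := by
  induction m generalizing g h with
  | zero => exact hg.zero_add hh
  | succ m ih =>
    obtain ⟨hg0, g', hgd, hg', hgv⟩ := hg
    obtain ⟨hh0, h', hhd, hh', hhv⟩ := hh
    exact ⟨TangentialCk.zero_add hg0 hh0, fun y => g' y + h' y,
      fun y hy => (hgd y hy).add (hhd y hy), TangentialCk.zero_add hg' hh',
      fun v => ih (hgv v) (hhv v)⟩

theorem TangentialCk.smul {u : V × ℝ → ℝ} {g : V × ℝ → W} (hu : TangentialCk A m u)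
    (hg : TangentialCk A m g) : TangentialCk A m (fun y => u y • g y) := by
  induction m generalizing u g with
  | zero => exact hu.zero_smul hg
  | succ m ih =>
    obtain ⟨hu0, u', hud, hu', huv⟩ := id hu
    obtain ⟨hg0, g', hgd, hg', hgv⟩ := id hg
    exact ⟨TangentialCk.zero_smul hu0 hg0, fun y => u y • g' y + (u' y).smulRight (g y),
      fun y hy => (hud y hy).smul (hgd y hy),
      TangentialCk.zero_add (TangentialCk.zero_smul hu0 hg') (TangentialCk.zero_smulRight hu' hg0),
      fun v => (ih hu.pred (hgv v)).add (ih (huv v) hg.pred)⟩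

theorem TangentialCk.const_mul {u : V × ℝ → ℝ} (c : ℝ) (hu : TangentialCk A m u) :
    TangentialCk A m (fun y => c * u y) := by
  induction m generalizing u with
  | zero =>
    obtain ⟨hu, C, hC⟩ := hu
    refine ⟨continuousOn_const.mul hu, |c| * C, fun y hy => ?_⟩
    rw [norm_mul, Real.norm_eq_abs c]
    exact mul_le_mul_of_nonneg_left (hC y hy) (abs_nonneg c)
  | succ m ih =>
    obtain ⟨⟨huc, C, hC⟩, u', hud, ⟨huc', C', hC'⟩, huv⟩ := hu
    refine ⟨⟨continuousOn_const.mul huc, |c| * C, fun y hy => ?_⟩, fun y => c • u' y,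
      fun y hy => (hud y hy).const_mul c,
      ⟨huc'.const_smul c, |c| * C', fun y hy => ?_⟩, fun v => ih (huv v)⟩
    · rw [norm_mul, Real.norm_eq_abs c]
      exact mul_le_mul_of_nonneg_left (hC y hy) (abs_nonneg c)
    · rw [norm_smul, Real.norm_eq_abs c]
      exact mul_le_mul_of_nonneg_left (hC' y hy) (abs_nonneg c)

theorem TangentialCk.zero_rpow_const {u : V × ℝ → ℝ} {c : ℝ} (hc : 0 < c) (hu : TangentialCk A 0 u)
    (hcu : ∀ y ∈ A, c ≤ u y) (a : ℝ) : TangentialCk A 0 (fun y => u y ^ a) := by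
  obtain ⟨hu, C, hC⟩ := hu
  refine ⟨hu.rpow_const fun y hy => Or.inl (hc.trans_le (hcu y hy)).ne', ?_⟩
  have hcont : ContinuousOn (fun r : ℝ => r ^ a) (Icc c C) :=
    continuousOn_id.rpow_const fun r hr => Or.inl (hc.trans_le hr.1).ne'
  obtain ⟨B, hB⟩ := isCompact_Icc.exists_bound_of_continuousOn hcont
  exact ⟨B, fun y hy => hB _ ⟨hcu y hy, (le_abs_self _).trans (hC y hy)⟩⟩

/-- The values of `u` stay in a compact interval of positive numbers, where every real power is
smooth and bounded. -/
theorem TangentialCk.rpow_const {u : V × ℝ → ℝ} {c : ℝ} (hc : 0 < c) (hu : TangentialCk A m u)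
    (hcu : ∀ y ∈ A, c ≤ u y) (a : ℝ) : TangentialCk A m (fun y => u y ^ a) := by
  induction m generalizing a with
  | zero => exact hu.zero_rpow_const hc hcu a
  | succ m ih =>
    obtain ⟨hu0, u', hud, hu', huv⟩ := id hu
    have h0 : TangentialCk A 0 (fun y => u y ^ a) := TangentialCk.zero_rpow_const hc hu0 hcu a
    have h1 : TangentialCk A 0 (fun y => a * u y ^ (a - 1)) :=
      (TangentialCk.zero_rpow_const hc hu0 hcu (a - 1)).const_mul a
    have hd : ∀ y ∈ A, HasFDerivAt (fun z => u (z, y.2) ^ a)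
        ((a * u y ^ (a - 1)) • u' y) y.1 := by
      intro y hy
      have hne : u (y.1, y.2) ≠ 0 := (hc.trans_le (hcu y hy)).ne'
      exact (hud y hy).rpow_const (Or.inl hne)
    exact ⟨h0, fun y => (a * u y ^ (a - 1)) • u' y, hd, h1.zero_smul hu',
      fun v => ((ih hu.pred (a - 1)).const_mul a).smul (huv v)⟩

theorem TangentialCk.congr {g h : V × ℝ → W} (hA : IsOpen A) (hg : TangentialCk A m g)
    (hgh : EqOn h g A) : TangentialCk A m h := by
  cases m with
  | zero =>
    obtain ⟨hg, C, hC⟩ := hg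
    exact ⟨hg.congr hgh, C, fun y hy => by rw [hgh hy]; exact hC y hy⟩
  | succ m =>
    obtain ⟨⟨hg, C, hC⟩, g', hgd, hg', hgv⟩ := hg
    refine ⟨⟨hg.congr hgh, C, fun y hy => by rw [hgh hy]; exact hC y hy⟩, g', fun y hy => ?_,
      hg', hgv⟩
    refine (hgd y hy).congr_of_eventuallyEq ?_
    have : ∀ᶠ z in 𝓝 y.1, (z, y.2) ∈ A :=
      (Continuous.prodMk_left y.2).continuousAt.eventually (hA.mem_nhds hy)
    filter_upwards [this] with z hz using hgh hz

theorem TangentialCk.zero_of_eq_zero_off {f : V × ℝ → W} {K A' : Set (V × ℝ)} (hA : IsOpen A)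
    (hK : IsClosed K) (hf : TangentialCk A 0 f) (hf0 : ∀ y ∉ K, f y = 0) (hA' : A' ⊆ A ∪ Kᶜ) :
    TangentialCk A' 0 f := by
  obtain ⟨hfc, C, hC⟩ := hf
  refine ⟨fun y hy => ?_, |C|, fun y hy => ?_⟩
  · rcases hA' hy with h | h
    · exact (hfc.continuousAt (hA.mem_nhds h)).continuousWithinAt
    · refine ContinuousAt.continuousWithinAt ?_
      have : f =ᶠ[𝓝 y] fun _ => 0 := by
        filter_upwards [hK.isOpen_compl.mem_nhds h] with z hz using hf0 z hz
      exact continuousAt_const.congr this.symm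
  · rcases hA' hy with h | h
    · exact (hC y h).trans (le_abs_self C)
    · rw [hf0 y h, norm_zero]; positivity

theorem TangentialCk.of_eq_zero_off {g : V × ℝ → W} {K A' : Set (V × ℝ)} (hA : IsOpen A)
    (hK : IsClosed K) (hg : TangentialCk A m g) (h0 : ∀ y ∉ K, g y = 0) (hA' : A' ⊆ A ∪ Kᶜ) :
    TangentialCk A' m g := by
  induction m generalizing g with
  | zero => exact hg.zero_of_eq_zero_off hA hK h0 hA'
  | succ m ih =>
    obtain ⟨hg0, g', hgd, hg', hgv⟩ := hg
    have hev : ∀ y ∉ K, (fun z => g (z, y.2)) =ᶠ[𝓝 y.1] fun _ => 0 := by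
      intro y hy
      have : ∀ᶠ z in 𝓝 y.1, (z, y.2) ∈ Kᶜ :=
        (Continuous.prodMk_left y.2).continuousAt.eventually (hK.isOpen_compl.mem_nhds hy)
      filter_upwards [this] with z hz using h0 _ hz
    -- The derivative is extended by zero off `K`. On `A` this changes nothing, since `g` vanishes
    -- near each point outside the closed set `K`.
    have heq : EqOn (K.indicator g') g' A := by
      intro y hy
      by_cases hyK : y ∈ K
      · simp [hyK]
      · rw [indicator_of_notMem hyK]
        exact ((hasFDerivAt_const (0 : W) y.1).congr_of_eventuallyEq (hev y hyK)).unique (hgd y hy)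
    refine ⟨TangentialCk.zero_of_eq_zero_off hA hK hg0 h0 hA', K.indicator g', fun y hy => ?_,
      TangentialCk.zero_of_eq_zero_off hA hK
        ⟨hg'.1.congr heq, ?_⟩ (fun y hy => indicator_of_notMem hy _) hA', fun v => ?_⟩
    · by_cases hyK : y ∈ K
      · have hyA : y ∈ A := (hA' hy).resolve_right fun h => h hyK
        rw [heq hyA]
        exact hgd y hyA
      · rw [indicator_of_notMem hyK]
        exact (hasFDerivAt_const (0 : W) y.1).congr_of_eventuallyEq (hev y hyK)
    · obtain ⟨-, C, hC⟩ := hg'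
      exact ⟨C, fun y hy => by rw [heq hy]; exact hC y hy⟩
    · refine ih ((hgv v).congr hA fun y hy => ?_) fun y hy => ?_
      · rw [heq hy]
      · rw [indicator_of_notMem hy]; rfl

theorem ContinuousOn.tangentialCk_zero {g : V × ℝ → W} {B : Set (V × ℝ)} (hB : IsCompact B)
    (hAB : A ⊆ B) (hg : ContinuousOn g B) : TangentialCk A 0 g := by
  obtain ⟨C, hC⟩ := hB.exists_bound_of_continuousOn hg
  exact ⟨hg.mono hAB, C, fun y hy => hC y (hAB hy)⟩

theorem ContDiffOn.tangentialCk {g : V × ℝ → W} {B : Set (V × ℝ)} (hB : IsCompact B)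
    (hBu : UniqueDiffOn ℝ B) (hAB : A ⊆ interior B) (hg : ContDiffOn ℝ m g B) :
    TangentialCk A m g := by
  have hAB' : A ⊆ B := hAB.trans interior_subset
  induction m generalizing g with
  | zero => exact hg.continuousOn.tangentialCk_zero hB hAB'
  | succ m ih =>
    have h1 : ContDiffOn ℝ m (fderivWithin ℝ g B) B :=
      hg.fderivWithin hBu (by push_cast; exact le_rfl)
    refine ⟨hg.continuousOn.tangentialCk_zero hB hAB',
      fun y => (fderivWithin ℝ g B y).comp (ContinuousLinearMap.inl ℝ V ℝ), fun y hy => ?_,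
      (h1.continuousOn.clm_comp continuousOn_const).tangentialCk_zero hB hAB', fun v => ?_⟩
    · have h2 := (hg.differentiableOn (by simp) y (hAB' hy)).hasFDerivWithinAt.hasFDerivAt
        (mem_interior_iff_mem_nhds.1 (hAB hy))
      exact h2.comp (f := fun z => (z, y.2)) y.1 (hasFDerivAt_prodMk_left y.1 y.2)
    · exact ih (h1.clm_apply contDiffOn_const)

theorem exists_norm_le_mul_of_eq_zero {r : ℝ} (hr : 0 < r) {f : V × ℝ → W} [ProperSpace V]
    (hf : ContDiffOn ℝ 1 f (Metric.closedBall 0 r ×ˢ Icc 0 r))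
    (h0 : ∀ y ∈ Metric.closedBall (0 : V) r, f (y, 0) = 0) :
    ∃ C, ∀ y ∈ Metric.closedBall (0 : V) r ×ˢ Icc 0 r, ‖f y‖ ≤ C * y.2 := by
  set B := Metric.closedBall (0 : V) r ×ˢ Icc (0 : ℝ) r with hB
  have hBc : IsCompact B := (isCompact_closedBall 0 r).prod isCompact_Icc
  have hBv : Convex ℝ B := (convex_closedBall 0 r).prod (convex_Icc 0 r)
  have hBu : UniqueDiffOn ℝ B := by
    refine (uniqueDiffOn_convex (convex_closedBall 0 r) ?_).prod (uniqueDiffOn_Icc hr)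
    exact ⟨0, Metric.ball_subset_interior_closedBall (Metric.mem_ball_self hr)⟩
  obtain ⟨C, hC⟩ := hBc.exists_bound_of_continuousOn
    (hf.continuousOn_fderivWithin hBu le_rfl)
  refine ⟨C, fun y hy => ?_⟩
  have hy0 : (y.1, (0 : ℝ)) ∈ B := ⟨hy.1, le_rfl, hr.le⟩
  have := hBv.norm_image_sub_le_of_norm_fderivWithin_le (hf.differentiableOn one_ne_zero) hC hy0 hy
  rw [h0 _ hy.1, sub_zero] at this
  refine this.trans_eq ?_
  congr 1
  have : y - (y.1, 0) = (0, y.2) := by ext <;> simp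
  rw [this, Prod.norm_def]
  simpa using hy.2.1

theorem ContDiffOn.tangentialCk_zero_inv_smul {r : ℝ} (hr : 0 < r) {f : V × ℝ → W} [ProperSpace V]
    (hf : ContDiffOn ℝ 1 f (Metric.closedBall 0 r ×ˢ Icc 0 r))
    (h0 : ∀ y ∈ Metric.closedBall (0 : V) r, f (y, 0) = 0) :
    TangentialCk (Metric.ball (0 : V) r ×ˢ Ioo 0 r) 0 (fun y => y.2⁻¹ • f y) := by
  set B := Metric.closedBall (0 : V) r ×ˢ Icc (0 : ℝ) r with hB
  have hAB' : Metric.ball (0 : V) r ×ˢ Ioo 0 r ⊆ B :=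
    prod_mono Metric.ball_subset_closedBall Ioo_subset_Icc_self
  have hinv : ContinuousOn (fun y : V × ℝ => y.2⁻¹) (Metric.ball (0 : V) r ×ˢ Ioo 0 r) :=
    continuousOn_snd.inv₀ fun y hy => hy.2.1.ne'
  obtain ⟨C, hC⟩ := exists_norm_le_mul_of_eq_zero hr hf h0
  refine ⟨hinv.smul (hf.continuousOn.mono hAB'), C, fun y hy => ?_⟩
  have h2 : 0 < y.2 := hy.2.1
  rw [norm_smul, norm_inv, Real.norm_of_nonneg h2.le, inv_mul_le_iff₀ h2, mul_comm]
  exact hC y (hAB' hy)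

/-- Tangential derivatives commute with division by the height and preserve vanishing at height `0`.
Hence only boundedness of the quotient is at stake, and the mean value inequality gives it at the
price of one derivative. -/
theorem ContDiffOn.tangentialCk_inv_mul {r : ℝ} (hr : 0 < r) {f : V × ℝ → ℝ} [ProperSpace V]
    (hf : ContDiffOn ℝ (m + 1) f (Metric.closedBall 0 r ×ˢ Icc 0 r))
    (h0 : ∀ y ∈ Metric.closedBall (0 : V) r, f (y, 0) = 0) :
    TangentialCk (Metric.ball (0 : V) r ×ˢ Ioo 0 r) m (fun y => y.2⁻¹ * f y) := by
  set B := Metric.closedBall (0 : V) r ×ˢ Icc (0 : ℝ) r with hB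
  have hcu : UniqueDiffOn ℝ (Metric.closedBall (0 : V) r) := uniqueDiffOn_convex (convex_closedBall 0 r)
    ⟨0, Metric.ball_subset_interior_closedBall (Metric.mem_ball_self hr)⟩
  have hBu : UniqueDiffOn ℝ B := hcu.prod (uniqueDiffOn_Icc hr)
  have hAB' : Metric.ball (0 : V) r ×ˢ Ioo 0 r ⊆ B :=
    prod_mono Metric.ball_subset_closedBall Ioo_subset_Icc_self
  have hAB : Metric.ball (0 : V) r ×ˢ Ioo 0 r ⊆ interior B :=
    interior_maximal hAB' (Metric.isOpen_ball.prod isOpen_Ioo)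
  induction m generalizing f with
  | zero => exact ContDiffOn.tangentialCk_zero_inv_smul hr (by simpa using hf) h0
  | succ m ih =>
    have h1 : ContDiffOn ℝ (m + 1) (fderivWithin ℝ f B) B :=
      hf.fderivWithin hBu (by push_cast; exact le_rfl)
    have hdiff := hf.differentiableOn (by simp)
    have h2 : ContDiffOn ℝ (m + 1)
        (fun y => (fderivWithin ℝ f B y).comp (ContinuousLinearMap.inl ℝ V ℝ)) B :=
      h1.clm_comp contDiffOn_const
    -- The tangential derivative vanishes at height `0` because `f` is constant there, so the
    -- induction hypothesis applies to it.
    have h3 : ∀ y ∈ Metric.closedBall (0 : V) r,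
        (fderivWithin ℝ f B (y, 0)).comp (ContinuousLinearMap.inl ℝ V ℝ) = 0 := by
      intro y hy
      have e1 : HasFDerivWithinAt (fun z => f (z, 0)) ((fderivWithin ℝ f B (y, 0)).comp
          (ContinuousLinearMap.inl ℝ V ℝ)) (Metric.closedBall 0 r) y :=
        (hdiff (y, 0) ⟨hy, le_rfl, hr.le⟩).hasFDerivWithinAt.comp (f := fun z => (z, (0 : ℝ))) y
          (hasFDerivAt_prodMk_left y 0).hasFDerivWithinAt fun z hz => ⟨hz, le_rfl, hr.le⟩
      have e2 : HasFDerivWithinAt (fun z => f (z, 0)) (0 : V →L[ℝ] ℝ) (Metric.closedBall 0 r) y :=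
        (hasFDerivWithinAt_const (0 : ℝ) y _).congr h0 (h0 y hy)
      exact (hcu y hy).eq e1 e2
    have hf1 : ContDiffOn ℝ 1 f B := hf.of_le (by exact_mod_cast Nat.le_add_left 1 (m + 1))
    refine ⟨hf1.tangentialCk_zero_inv_smul hr h0,
      fun y => y.2⁻¹ • (fderivWithin ℝ f B y).comp (ContinuousLinearMap.inl ℝ V ℝ),
      fun y hy => ?_, ContDiffOn.tangentialCk_zero_inv_smul hr
        (h2.of_le (by exact_mod_cast Nat.le_add_left 1 m)) h3, fun v => ?_⟩
    · have e1 := (hdiff y (hAB' hy)).hasFDerivWithinAt.hasFDerivAt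
        (mem_interior_iff_mem_nhds.1 (hAB hy))
      have e2 : HasFDerivAt (fun z => f (z, y.2)) _ y.1 :=
        e1.comp (f := fun z => (z, y.2)) y.1 (hasFDerivAt_prodMk_left y.1 y.2)
      exact e2.const_mul y.2⁻¹
    · exact ih (f := fun y => fderivWithin ℝ f B y (v, 0))
        (fun y hy => DFunLike.congr_fun (h3 y hy) v) (h1.clm_apply contDiffOn_const)

end TangentialCk

/-! ### Parametric integrals and Hadamard's lemma. -/

section ParametricIntegral

variable {X W : Type*} [NormedAddCommGroup X] [NormedSpace ℝ X] [FiniteDimensional ℝ X]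
  [NormedAddCommGroup W] [NormedSpace ℝ W] [CompleteSpace W]

theorem hasFDerivAt_parametric_intervalIntegral {f : X × ℝ → W} (hf : ContDiff ℝ 1 f) (a b : ℝ)
    (x : X) : HasFDerivAt (fun x => ∫ r in a..b, f (x, r))
      (∫ r in a..b, (fderiv ℝ f (x, r)).comp (ContinuousLinearMap.inl ℝ X ℝ)) x := by
  have hc : Continuous fun q : X × ℝ => (fderiv ℝ f q).comp (ContinuousLinearMap.inl ℝ X ℝ) :=
    (hf.continuous_fderiv one_ne_zero).clm_comp continuous_const
  obtain ⟨C, hC⟩ := ((isCompact_closedBall x 1).prod (isCompact_uIcc (a := a) (b := b))).exists_bound_of_continuousOn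
    hc.continuousOn
  refine intervalIntegral.hasFDerivAt_integral_of_dominated_of_fderiv_le (bound := fun _ => C)
    (F' := fun x r => (fderiv ℝ f (x, r)).comp (ContinuousLinearMap.inl ℝ X ℝ))
    (Metric.ball_mem_nhds x one_pos) (Eventually.of_forall fun x => ?_) ?_ ?_
    (ae_of_all _ fun t ht x' hx' => ?_) intervalIntegrable_const (ae_of_all _ fun t ht x' hx' => ?_)
  · exact (hf.continuous.comp (Continuous.prodMk_right x)).aestronglyMeasurable
  · exact (hf.continuous.comp (Continuous.prodMk_right x)).intervalIntegrable a b
  · exact (hc.comp (Continuous.prodMk_right x)).aestronglyMeasurable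
  · exact hC (x', t) ⟨Metric.ball_subset_closedBall hx', uIoc_subset_uIcc ht⟩
  · exact ((hf.differentiable one_ne_zero) (x', t)).hasFDerivAt.comp (f := fun x => (x, t)) x'
      (hasFDerivAt_prodMk_left x' t)

theorem contDiff_parametric_intervalIntegral {N : ℕ} {f : X × ℝ → W} (hf : ContDiff ℝ N f)
    (a b : ℝ) : ContDiff ℝ N (fun x => ∫ r in a..b, f (x, r)) := by
  induction N generalizing f with
  | zero =>
    refine contDiff_zero.2 ?_
    exact intervalIntegral.continuous_parametric_intervalIntegral_of_continuous'
      (f := fun x r => f (x, r)) (by simpa [Function.uncurry_def] using hf.continuous) a b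
  | succ N ih =>
    have hf1 : ContDiff ℝ 1 f := hf.of_le (by exact_mod_cast Nat.le_add_left 1 N)
    have hd := hasFDerivAt_parametric_intervalIntegral hf1 a b
    push_cast
    refine contDiff_succ_iff_fderiv_apply.2 ⟨fun x => (hd x).differentiableAt, ?_, fun v => ?_⟩
    · intro h
      exact absurd h (by exact_mod_cast WithTop.coe_ne_top)
    · have h1 : (fun x => fderiv ℝ (fun x => ∫ r in a..b, f (x, r)) x v) =
          fun x => ∫ r in a..b, fderiv ℝ f (x, r) (v, 0) := by
        funext x
        rw [(hd x).fderiv, ContinuousLinearMap.intervalIntegral_apply]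
        · simp
        · exact (((hf1.continuous_fderiv one_ne_zero).clm_comp continuous_const).comp
            (Continuous.prodMk_right x)).intervalIntegrable a b
      rw [h1]
      exact ih ((hf.fderiv_right (by push_cast; exact le_rfl)).clm_apply contDiff_const)

/-- Hadamard's lemma: increments of a smooth function factor smoothly through the displacement. -/
theorem exists_contDiff_sub_eq_apply {N : ℕ} {γ : X → ℝ} (hγ : ContDiff ℝ (N + 1) γ) :
    ∃ B : X × X → X →L[ℝ] ℝ, ContDiff ℝ N B ∧ ∀ x w, γ (x + w) - γ x = B (x, w) w := by
  refine ⟨fun q => ∫ r in (0 : ℝ)..1, fderiv ℝ γ (q.1 + r • q.2), ?_, fun x w => ?_⟩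
  · refine contDiff_parametric_intervalIntegral (X := X × X)
      (f := fun q => fderiv ℝ γ (q.1.1 + q.2 • q.1.2)) ?_ 0 1
    exact (hγ.fderiv_right le_rfl).comp (by fun_prop)
  · have hγ1 : ContDiff ℝ 1 γ := hγ.of_le (by exact_mod_cast Nat.le_add_left 1 N)
    have hc : Continuous fun r : ℝ => fderiv ℝ γ (x + r • w) :=
      (hγ1.continuous_fderiv one_ne_zero).comp (by fun_prop)
    rw [ContinuousLinearMap.intervalIntegral_apply (hc.intervalIntegrable 0 1)]
    have hd : ∀ r ∈ uIcc (0 : ℝ) 1, HasDerivAt (fun r : ℝ => γ (x + r • w))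
        (fderiv ℝ γ (x + r • w) w) r := by
      intro r _
      have h1 : HasDerivAt (fun r : ℝ => x + r • w) w r := by
        simpa using ((hasDerivAt_id r).smul_const w).const_add x
      exact ((hγ1.differentiable one_ne_zero) _).hasFDerivAt.comp_hasDerivAt r h1
    rw [intervalIntegral.integral_eq_sub_of_hasDerivAt hd
      ((hc.clm_apply continuous_const).intervalIntegrable 0 1)]
    simp

end ParametricIntegral

/-! ### The distance to a point of a graph as a singular kernel. -/

section Straightening

variable {V E : Type*} [NormedAddCommGroup V] [NormedSpace ℝ V] [FiniteDimensional ℝ V]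
  [NormedAddCommGroup E] [InnerProductSpace ℝ E] [FiniteDimensional ℝ E] (T : (V × ℝ) ≃L[ℝ] E)

/-- A power of the distance between points above and on a graph is a singular kernel with a
compactly supported profile, as long as the points remain bounded. -/
theorem exists_profile_graph {N : ℕ} {γ : V → ℝ} (hγ : ContDiff ℝ (N + 1) γ) (p R : ℝ) (hR : 0 < R) :
    ∃ Ξ : V × E × E → ℝ, ContDiff ℝ N Ξ ∧ HasCompactSupport Ξ ∧
      ∀ x w, ‖x‖ ≤ R → ‖T w‖ ≤ R → w ≠ 0 →
        singularKernel p Ξ x (T w) = ‖T (w.1, w.2 + (γ (x + w.1) - γ x))‖ ^ (-p) := by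
  obtain ⟨B, hB, hBγ⟩ := exists_contDiff_sub_eq_apply hγ
  -- `χ₁` and `χ₂` localize the base point and `a`. The factor `χ₃ * (1 - χ₄)` equals `1` on the
  -- unit sphere, where directions lie, and removes a neighbourhood of `0` and of infinity.
  let χ₁ : ContDiffBump (0 : V) := ⟨R, R + 1, hR, by linarith⟩
  let χ₂ : ContDiffBump (0 : E) := ⟨R, R + 1, hR, by linarith⟩
  let χ₃ : ContDiffBump (0 : E) := ⟨1, 2, one_pos, one_lt_two⟩
  let χ₄ : ContDiffBump (0 : E) := ⟨1 / 4, 1 / 2, by norm_num, by norm_num⟩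
  -- By Hadamard's lemma the displacement is linear in `w` once the coefficient `B` is frozen. `Y`
  -- applies this shear to the direction only; being invertible, it has no zero away from direction
  -- `0`.
  let Y : V × E × E → E := fun q => T ((T.symm q.2.2).1,
    (T.symm q.2.2).2 + B (q.1, (T.symm q.2.1).1) (T.symm q.2.2).1)
  have hY : ContDiff ℝ N Y := by
    refine T.contDiff.comp (ContDiff.prodMk ?_ (ContDiff.add ?_ (ContDiff.clm_apply (hB.comp ?_) ?_)))
    · exact contDiff_fst.comp (T.symm.contDiff.comp (contDiff_snd.comp contDiff_snd))
    · exact contDiff_snd.comp (T.symm.contDiff.comp (contDiff_snd.comp contDiff_snd))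
    · exact contDiff_fst.prodMk
        (contDiff_fst.comp (T.symm.contDiff.comp (contDiff_fst.comp contDiff_snd)))
    · exact contDiff_fst.comp (T.symm.contDiff.comp (contDiff_snd.comp contDiff_snd))
  have hY0 : ∀ q, q.2.2 ≠ 0 → Y q ≠ 0 := by
    intro q hq h
    rw [ContinuousLinearEquiv.map_eq_zero_iff, Prod.mk_eq_zero] at h
    obtain ⟨h1, h2⟩ := h
    rw [h1, map_zero, add_zero] at h2
    exact hq ((ContinuousLinearEquiv.map_eq_zero_iff T.symm).1 (Prod.ext h1 h2))
  refine ⟨fun q => χ₁ q.1 * χ₂ q.2.1 * (χ₃ q.2.2 * (1 - χ₄ q.2.2)) * ‖Y q‖ ^ (-p), ?_, ?_, ?_⟩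
  · rw [contDiff_iff_contDiffAt]
    intro q
    by_cases hq : q.2.2 = 0
    · have h1 : ∀ᶠ q' : V × E × E in 𝓝 q, χ₄ q'.2.2 = 1 := by
        have : Tendsto (fun q' : V × E × E => q'.2.2) (𝓝 q) (𝓝 0) := by
          rw [← hq]
          exact (continuous_snd.comp continuous_snd).tendsto q
        exact this.eventually χ₄.eventuallyEq_one
      refine (contDiffAt_const (c := (0 : ℝ))).congr_of_eventuallyEq ?_
      filter_upwards [h1] with q' hq'
      simp [hq']
    · refine ContDiffAt.mul ?_ ((hY.contDiffAt.norm ℝ (hY0 q hq)).rpow_const_of_ne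
        (norm_ne_zero_iff.2 (hY0 q hq)))
      refine ContDiff.contDiffAt ?_
      exact ((χ₁.contDiff.comp contDiff_fst).mul (χ₂.contDiff.comp (contDiff_fst.comp contDiff_snd))).mul
        ((χ₃.contDiff.comp (contDiff_snd.comp contDiff_snd)).mul
          (contDiff_const.sub (χ₄.contDiff.comp (contDiff_snd.comp contDiff_snd))))
  · refine HasCompactSupport.intro (K := Metric.closedBall 0 (R + 1) ×ˢ
      (Metric.closedBall 0 (R + 1) ×ˢ Metric.closedBall 0 2))
      ((isCompact_closedBall _ _).prod ((isCompact_closedBall _ _).prod (isCompact_closedBall _ _)))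
      fun q hq => ?_
    have h1 : R + 1 < ‖q.1‖ ∨ R + 1 < ‖q.2.1‖ ∨ 2 < ‖q.2.2‖ := by
      by_contra! h
      exact hq ⟨by simpa using h.1, by simpa using h.2.1, by simpa using h.2.2⟩
    rcases h1 with h | h | h
    · have : χ₁ q.1 = 0 := χ₁.zero_of_le_dist (by simpa using h.le)
      simp [this]
    · have : χ₂ q.2.1 = 0 := χ₂.zero_of_le_dist (by simpa using h.le)
      simp [this]
    · have : χ₃ q.2.2 = 0 := χ₃.zero_of_le_dist (by simpa using h.le)
      simp [this]
  · intro x w hx hw hw0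
    have hTw : T w ≠ 0 := by rwa [Ne, ContinuousLinearEquiv.map_eq_zero_iff]
    have ha : 0 < ‖T w‖ := norm_pos_iff.2 hTw
    have hu : ‖‖T w‖⁻¹ • T w‖ = 1 := by rw [norm_smul, norm_inv, norm_norm, inv_mul_cancel₀ ha.ne']
    have h1 : χ₁ x = 1 := χ₁.one_of_mem_closedBall (by simpa using hx)
    have h2 : χ₂ (T w) = 1 := χ₂.one_of_mem_closedBall (by simpa using hw)
    have h3 : χ₃ (‖T w‖⁻¹ • T w) = 1 := χ₃.one_of_mem_closedBall (by simp [hu, χ₃])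
    have h4 : χ₄ (‖T w‖⁻¹ • T w) = 0 := χ₄.zero_of_le_dist (by simp only [χ₄, dist_zero_right, hu]; norm_num)
    have h5 : T (w.1, w.2 + (γ (x + w.1) - γ x)) = ‖T w‖ • Y (x, T w, ‖T w‖⁻¹ • T w) := by
      simp only [Y, T.symm_apply_apply, ← map_smul, hBγ]
      congr 1
      ext
      · simp [smul_smul, mul_inv_cancel₀ ha.ne']
      · simp only [Prod.smul_fst, Prod.smul_snd, map_smul, Prod.smul_mk, smul_eq_mul, ← mul_add]
        rw [mul_inv_cancel_left₀ ha.ne']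
    rw [h5, norm_smul, norm_norm, Real.mul_rpow ha.le (norm_nonneg _), singularKernel]
    simp only [h1, h2, h3, h4, sub_zero, mul_one, one_mul]

end Straightening

/-! ### The boundary as a graph, by the implicit function theorem. -/

section Graph

theorem exists_equiv_ker_prod {E : Type*} [NormedAddCommGroup E] [NormedSpace ℝ E]
    [FiniteDimensional ℝ E] (ℓ : E →L[ℝ] ℝ) (hℓ : ℓ ≠ 0) :
    ∃ (V : Submodule ℝ E) (T : (V × ℝ) ≃L[ℝ] E), ∀ w, ℓ (T w) = -w.2 := by
  obtain ⟨u, hu⟩ : ∃ u, ℓ u ≠ 0 := by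
    by_contra! h
    exact hℓ (ContinuousLinearMap.ext h)
  -- The sign makes increasing height lower the defining function, so positive heights point into
  -- the domain.
  obtain ⟨v, hv⟩ : ∃ v, ℓ v = -1 := ⟨(-(ℓ u)⁻¹) • u, by simp [hu]⟩
  let L : (LinearMap.ker (ℓ : E →ₗ[ℝ] ℝ) × ℝ) ≃ₗ[ℝ] E :=
    { toFun := fun w => w.1 + w.2 • v
      invFun := fun x => (⟨x + ℓ x • v, by simp [hv]⟩, -ℓ x)
      map_add' := fun a b => by simp only [Prod.fst_add, Prod.snd_add, Submodule.coe_add, add_smul]; abel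
      map_smul' := fun c a => by simp [smul_smul]
      left_inv := fun w => by
        have : ℓ (w.1 : E) = 0 := w.1.2
        ext <;> simp [hv, this]
      right_inv := fun x => by simp }
  refine ⟨_, L.toContinuousLinearEquiv, fun w => ?_⟩
  have : ℓ (w.1 : E) = 0 := w.1.2
  change ℓ (w.1 + w.2 • v) = _
  simp [hv, this]

theorem exists_contDiff_hasCompactSupport_eqOn {V : Type*} [NormedAddCommGroup V] [NormedSpace ℝ V]
    [FiniteDimensional ℝ V] {N : ℕ} {f : V → ℝ} (hf : ContDiffAt ℝ N f 0) :
    ∃ (g : V → ℝ) (r : ℝ), 0 < r ∧ ContDiff ℝ N g ∧ HasCompactSupport g ∧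
      EqOn g f (Metric.ball 0 r) := by
  obtain ⟨r, hr, h⟩ := Metric.eventually_nhds_iff_ball.1 (hf.eventually (by simp))
  let χ : ContDiffBump (0 : V) := ⟨r / 4, r / 2, by positivity, by linarith⟩
  refine ⟨fun x => χ x * f x, r / 4, by positivity, ?_, χ.hasCompactSupport.mul_right, ?_⟩
  · rw [contDiff_iff_contDiffAt]
    intro x
    by_cases hx : x ∈ Metric.ball (0 : V) r
    · exact χ.contDiffAt.mul (h x hx)
    · refine (contDiffAt_const (c := (0 : ℝ))).congr_of_eventuallyEq ?_
      have hx' : r / 2 < dist x 0 := by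
        have : r ≤ dist x 0 := by simpa using hx
        linarith
      have : ∀ᶠ y in 𝓝 x, r / 2 < dist y 0 :=
        (continuous_id.dist continuous_const).continuousAt.eventually (lt_mem_nhds hx')
      filter_upwards [this] with y hy
      simp [χ.zero_of_le_dist hy.le]
  · intro x hx
    have : χ x = 1 := χ.one_of_mem_closedBall (Metric.ball_subset_closedBall hx)
    simp [this]

/-- Near a boundary point, an open set with smooth boundary is the region above a graph. -/
theorem HasSmoothBoundary.exists_graph {n : ℕ} {Ω : Set (EuclideanSpace ℝ (Fin n))}
    (hΩ : HasSmoothBoundary Ω) {z : EuclideanSpace ℝ (Fin n)} (hz : z ∈ frontier Ω) (N : ℕ) :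
    ∃ (V : Submodule ℝ (EuclideanSpace ℝ (Fin n)))
      (T : (V × ℝ) ≃L[ℝ] EuclideanSpace ℝ (Fin n)) (γ : V → ℝ) (r : ℝ), 0 < r ∧
      ContDiff ℝ N γ ∧ HasCompactSupport γ ∧ γ 0 = 0 ∧
      ∀ y t, ‖y‖ < r → |t| < r → (z + T (y, γ y + t) ∈ Ω ↔ 0 < t) := by
  obtain ⟨U, ρ, hU, hzU, hρ, hρz, hdρ, hΩρ⟩ := hΩ z hz
  obtain ⟨V, T, hT⟩ := exists_equiv_ker_prod (fderiv ℝ ρ z) hdρ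
  let P : V × ℝ → EuclideanSpace ℝ (Fin n) := fun w => z + T w
  have hP : ContDiff ℝ (N + 1) P := contDiff_const.add T.contDiff
  have hP0 : P 0 = z := by simp [P]
  have hdP : ∀ w, HasFDerivAt P (T : V × ℝ →L[ℝ] EuclideanSpace ℝ (Fin n)) w := fun w =>
    (T : V × ℝ →L[ℝ] EuclideanSpace ℝ (Fin n)).hasFDerivAt.const_add z
  have hρz' : ContDiffAt ℝ ∞ ρ z := hρ.contDiffAt (hU.mem_nhds hzU)
  let F : V × ℝ → ℝ := fun w => ρ (P w)
  have hF0 : F 0 = 0 := by simp [F, hP0, hρz]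
  have hF : ContDiffAt ℝ (N + 1) F 0 := by
    refine ContDiffAt.comp 0 ?_ hP.contDiffAt
    rw [hP0]
    exact hρz'.of_le (by exact_mod_cast le_top)
  have hdF : HasFDerivAt F ((fderiv ℝ ρ z).comp (T : V × ℝ →L[ℝ] EuclideanSpace ℝ (Fin n))) 0 := by
    refine HasFDerivAt.comp 0 ?_ (hdP 0)
    rw [hP0]
    exact (hρz'.differentiableAt (by simp)).hasFDerivAt
  have hinv : (fderiv ℝ F 0 ∘L .inr ℝ V ℝ).IsInvertible := by
    refine ⟨ContinuousLinearEquiv.neg ℝ, ?_⟩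
    ext
    simp [hdF.fderiv, hT]
  have hN : ((N : ℕ∞ω) + 1) ≠ 0 := by simp
  set γ₀ := hF.implicitFunction hN hinv with hγ₀
  have hγ₀0 : γ₀ 0 = 0 := hF.implicitFunction_apply_self hN hinv
  have hγ₀F : ∀ᶠ y in 𝓝 (0 : V), F (y, γ₀ y) = 0 := by
    have := hF.eventually_apply_implicitFunction hN hinv
    rwa [hF0] at this
  have hγ₀c : ContDiffAt ℝ N γ₀ 0 := (hF.contDiffAt_implicitFunction hN hinv).of_le (by simp)
  obtain ⟨γ, r₀, hr₀, hγ, hγc, hγγ₀⟩ := exists_contDiff_hasCompactSupport_eqOn hγ₀c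
  have hγ0 : γ 0 = 0 := by rw [hγγ₀ (Metric.mem_ball_self hr₀), hγ₀0]
  have hγF : ∀ᶠ y in 𝓝 (0 : V), F (y, γ y) = 0 := by
    filter_upwards [hγ₀F, Metric.ball_mem_nhds 0 hr₀] with y hy hy'
    rw [hγγ₀ hy', hy]
  have hdec : ∀ᶠ w in 𝓝 (0 : V × ℝ), P w ∈ U ∧ fderiv ℝ ρ (P w) (T (0, 1)) < 0 := by
    have h1 : ∀ᶠ x in 𝓝 z, x ∈ U ∧ fderiv ℝ ρ x (T (0, 1)) < 0 := by
      refine (hU.eventually_mem hzU).and ?_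
      have h2 : ContinuousAt (fun x => fderiv ℝ ρ x (T (0, 1))) z :=
        ((hρ.continuousOn_fderiv_of_isOpen hU (by simp)).continuousAt (hU.mem_nhds hzU)).clm_apply
          continuousAt_const
      refine h2.eventually (gt_mem_nhds ?_)
      simp [hT]
    have h3 : Tendsto P (𝓝 0) (𝓝 z) := by
      have := hP.continuous.tendsto 0
      rwa [hP0] at this
    exact h3.eventually h1
  obtain ⟨r₁, hr₁, h₁⟩ := Metric.eventually_nhds_iff_ball.1 hdec
  have hγsmall : ∀ᶠ y in 𝓝 (0 : V), |γ y| < r₁ / 2 := by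
    have : Tendsto (fun y => |γ y|) (𝓝 0) (𝓝 0) := by
      have := (hγ.continuous.abs).tendsto 0
      rwa [hγ0, abs_zero] at this
    exact this.eventually (gt_mem_nhds (by positivity))
  obtain ⟨r₂, hr₂, h₂⟩ := Metric.eventually_nhds_iff_ball.1 (hγF.and hγsmall)
  -- `γ y` and `t` are each below `r₁ / 2` in absolute value, so `γ y + t` stays where the defining
  -- function is strictly decreasing in height.
  refine ⟨V, T, γ, min r₂ (r₁ / 2), by positivity, hγ, hγc, hγ0, fun y t hy ht => ?_⟩
  obtain ⟨hFy, hγy⟩ := h₂ y (by simpa using hy.trans_le (min_le_left _ _))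
  have hy1 : ‖y‖ < r₁ := by
    have := hy.trans_le (min_le_right r₂ (r₁ / 2))
    linarith
  have ht1 : |t| < r₁ / 2 := ht.trans_le (min_le_right _ _)
  have hmem : ∀ u ∈ Ioo (-r₁) r₁, (y, u) ∈ Metric.ball (0 : V × ℝ) r₁ := by
    intro u hu
    rw [mem_ball_zero_iff, Prod.norm_def]
    exact max_lt hy1 (abs_lt.2 hu)
  have hderiv : ∀ u ∈ Ioo (-r₁) r₁,
      HasDerivAt (fun u => F (y, u)) (fderiv ℝ ρ (P (y, u)) (T (0, 1))) u := by
    intro u hu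
    have e1 : HasDerivAt (fun u => P (y, u)) (T (0, 1)) u :=
      (hdP (y, u)).comp_hasDerivAt (f := fun u => (y, u)) u
        ((hasDerivAt_const u y).prodMk (hasDerivAt_id u))
    have e2 : HasFDerivAt ρ (fderiv ℝ ρ (P (y, u))) (P (y, u)) :=
      ((hρ.contDiffAt (hU.mem_nhds (h₁ _ (hmem u hu)).1)).differentiableAt (by simp)).hasFDerivAt
    exact e2.comp_hasDerivAt u e1
  have hanti : StrictAntiOn (fun u => F (y, u)) (Ioo (-r₁) r₁) := by
    refine strictAntiOn_of_deriv_neg (convex_Ioo _ _)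
      (fun u hu => (hderiv u hu).continuousAt.continuousWithinAt) fun u hu => ?_
    rw [interior_Ioo] at hu
    rw [(hderiv u hu).deriv]
    exact (h₁ _ (hmem u hu)).2
  rw [abs_lt] at ht1 hγy
  have hm1 : γ y ∈ Ioo (-r₁) r₁ := ⟨by linarith, by linarith⟩
  have hm2 : γ y + t ∈ Ioo (-r₁) r₁ := ⟨by linarith, by linarith⟩
  have key := hanti.lt_iff_gt hm2 hm1
  rw [hFy] at key
  rw [hΩρ _ (h₁ _ (hmem _ hm2)).1]
  exact key.trans (lt_add_iff_pos_right _)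

end Graph

/-! ### Riesz kernels: absolute convergence, and smoothness away from the density. -/

section RieszKernel

variable {E W : Type*} [NormedAddCommGroup E] [InnerProductSpace ℝ E] [FiniteDimensional ℝ E]
  [MeasurableSpace E] [BorelSpace E] (μ : Measure E) [μ.IsAddHaarMeasure]
  [NormedAddCommGroup W] [NormedSpace ℝ W]

theorem integrableOn_norm_sub_rpow_smul {Ω : Set E} (hΩ : Bornology.IsBounded Ω)
    (hΩm : MeasurableSet Ω) {p : ℝ} (hn : 1 ≤ Module.finrank ℝ E) (hp : p < Module.finrank ℝ E)
    {f : E → W} (hf : AEStronglyMeasurable f (μ.restrict Ω)) {C : ℝ} (hC : ∀ y ∈ Ω, ‖f y‖ ≤ C)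
    (x : E) : IntegrableOn (fun y => ‖x - y‖ ^ (-p) • f y) Ω μ := by
  obtain ⟨R, hR⟩ : ∃ R, ∀ y ∈ Ω, ‖x - y‖ < R := by
    obtain ⟨R, -, hR⟩ := hΩ.exists_pos_norm_lt
    refine ⟨‖x‖ + R, fun y hy => (norm_sub_le x y).trans_lt ?_⟩
    have := hR y hy
    linarith
  have hm : Measurable fun w : E => ‖w‖ ^ (-p) := measurable_norm.pow_const _
  have h1 : Integrable ((Metric.ball (0 : E) R).indicator fun w => ‖w‖ ^ (-p)) μ := by
    rw [integrable_indicator_iff Metric.isOpen_ball.measurableSet]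
    refine integrableOn_ball_of_norm_le_rpow (C := 1) (α := p) hn hp (ae_of_all _ fun w => ?_)
      hm.aestronglyMeasurable
    rw [one_mul, Real.norm_of_nonneg (by positivity)]
  have h2 := ((h1.comp_sub_left x).mul_const C).integrableOn (s := Ω)
  refine Integrable.mono' h2 ?_ ?_
  · exact (hm.comp (measurable_const.sub measurable_id)).aestronglyMeasurable.smul hf
  · filter_upwards [ae_restrict_mem hΩm] with y hy
    rw [indicator_of_mem (by simpa using hR y hy), norm_smul, Real.norm_of_nonneg (by positivity)]
    exact mul_le_mul_of_nonneg_left (hC y hy) (by positivity)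

/-- The potential of a density vanishing near `z` is smooth near `z`. -/
theorem exists_contDiff_eq_integral_norm_sub_rpow [CompleteSpace W] {h : E → W}
    (hh : Integrable h μ) {R : ℝ} (hR : ∀ y, R ≤ ‖y‖ → h y = 0) {z : E} {ε : ℝ} (hε : 0 < ε)
    (hz : ∀ y ∈ Metric.ball z ε, h y = 0) (p : ℝ) (N : ℕ) :
    ∃ G : E → W, ContDiff ℝ N G ∧
      ∀ x ∈ Metric.ball z (ε / 2), ∫ y, ‖x - y‖ ^ (-p) • h y ∂μ = G x := by
  have hR1 : 0 < ‖z‖ + ε + |R| := by positivity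
  let χ₁ : ContDiffBump (0 : E) := ⟨‖z‖ + ε + |R|, ‖z‖ + ε + |R| + 1, hR1, by linarith⟩
  let χ₂ : ContDiffBump (0 : E) := ⟨ε / 4, ε / 2, by positivity, by linarith⟩
  -- Only displacements between `ε / 2` and `‖z‖ + ε + |R|` occur, so truncating the kernel near `0`
  -- and infinity changes nothing and leaves a convolution with a smooth compactly supported kernel.
  let κ : E → ℝ := fun w => χ₁ w * ((1 - χ₂ w) * ‖w‖ ^ (-p))
  have hκ : ContDiff ℝ N κ := by
    rw [contDiff_iff_contDiffAt]
    intro w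
    by_cases hw : w = 0
    · refine (contDiffAt_const (c := (0 : ℝ))).congr_of_eventuallyEq ?_
      rw [hw]
      filter_upwards [χ₂.eventuallyEq_one] with w' hw'
      simp [κ, hw']
    · exact χ₁.contDiffAt.mul ((contDiffAt_const.sub χ₂.contDiffAt).mul
        ((contDiffAt_id.norm ℝ hw).rpow_const_of_ne (norm_ne_zero_iff.2 hw)))
  have hκc : HasCompactSupport κ := χ₁.hasCompactSupport.mul_right
  refine ⟨_, hκc.contDiff_convolution_right (n := N) (μ := μ)
    (ContinuousLinearMap.lsmul ℝ ℝ : ℝ →L[ℝ] W →L[ℝ] W).flip hh.locallyIntegrable hκ,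
    fun x hx => ?_⟩
  refine integral_congr_ae (ae_of_all _ fun y => ?_)
  by_cases hy : h y = 0
  · simp [hy]
  have h1 : ‖y‖ < R := not_le.1 fun h' => hy (hR y h')
  have h2 : ε ≤ ‖y - z‖ := by
    by_contra! h'
    exact hy (hz y (by simpa [dist_eq_norm] using h'))
  have h3 : ‖x - z‖ < ε / 2 := by simpa [dist_eq_norm] using hx
  have h4 : ε / 2 ≤ ‖x - y‖ := by
    have : ‖y - z‖ ≤ ‖x - y‖ + ‖x - z‖ := by
      have := norm_sub_le (x - z) (x - y)
      rw [sub_sub_sub_cancel_left] at this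
      linarith
    linarith
  have h5 : ‖x - y‖ ≤ ‖z‖ + ε + |R| := by
    have e1 : ‖x‖ ≤ ‖x - z‖ + ‖z‖ := by simpa using norm_add_le (x - z) z
    have := norm_sub_le x y
    have := le_abs_self R
    linarith
  have e1 : χ₁ (x - y) = 1 := χ₁.one_of_mem_closedBall (by simpa using h5)
  have e2 : χ₂ (x - y) = 0 := χ₂.zero_of_le_dist (by simpa using h4)
  simp [κ, e1, e2]

end RieszKernel

/-! ### The chart that flattens the boundary. -/

section GraphChart

variable {V E W : Type*} [NormedAddCommGroup V] [NormedSpace ℝ V] [FiniteDimensional ℝ V]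
  [NormedAddCommGroup E] [InnerProductSpace ℝ E] [FiniteDimensional ℝ E]
  [NormedAddCommGroup W] [NormedSpace ℝ W]

/-- The coordinates of `E` in which a point is given by its projection `y` along `T (0, 1)` and its
height `t` above the graph of `γ`. -/
noncomputable def graphChart (T : (V × ℝ) ≃L[ℝ] E) {γ : V → ℝ} (hγ : Continuous γ) (z : E) :
    (V × ℝ) ≃ₜ E where
  toFun y := z + T (y.1, γ y.1 + y.2)
  invFun x := ((T.symm (x - z)).1, (T.symm (x - z)).2 - γ (T.symm (x - z)).1)
  left_inv y := by simp
  right_inv x := by simp only [add_sub_cancel, Prod.mk.eta, T.apply_symm_apply]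
  continuous_toFun := by fun_prop
  continuous_invFun := by fun_prop

variable (T : (V × ℝ) ≃L[ℝ] E) {γ : V → ℝ} (hγ : Continuous γ) (z : E)

theorem graphChart_apply (y : V × ℝ) : graphChart T hγ z y = z + T (y.1, γ y.1 + y.2) := rfl

theorem graphChart_symm_apply (x : E) : (graphChart T hγ z).symm x =
    ((T.symm (x - z)).1, (T.symm (x - z)).2 - γ (T.symm (x - z)).1) := rfl

theorem graphChart_symm_self (hγ0 : γ 0 = 0) : (graphChart T hγ z).symm z = 0 := by
  simp [graphChart_symm_apply, hγ0]

theorem contDiff_graphChart {N : ℕ∞ω} (hγN : ContDiff ℝ N γ) :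
    ContDiff ℝ N (graphChart T hγ z) :=
  contDiff_const.add (T.contDiff.comp
    (contDiff_fst.prodMk ((hγN.comp contDiff_fst).add contDiff_snd)))

theorem contDiff_graphChart_symm_fst {N : ℕ∞ω} :
    ContDiff ℝ N fun x => ((graphChart T hγ z).symm x).1 := by
  have h : ContDiff ℝ N fun x => (T.symm (x - z)).1 :=
    contDiff_fst.comp (T.symm.contDiff.comp (contDiff_id.sub contDiff_const))
  exact h

theorem exists_lipschitzWith_graphChart_symm (hγ1 : ContDiff ℝ 1 γ) (hc : HasCompactSupport γ) :
    ∃ L, LipschitzWith L (graphChart T hγ z).symm := by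
  obtain ⟨C, hC⟩ := hγ1.lipschitzWith_of_hasCompactSupport hc one_ne_zero
  have h1 : LipschitzWith _ fun x => T.symm (x - z) :=
    T.symm.lipschitz.comp ((LipschitzWith.id).sub (LipschitzWith.const z))
  have h2 := LipschitzWith.prod_fst.comp h1
  have h3 := LipschitzWith.prod_snd.comp h1
  exact ⟨_, h2.prodMk (h3.sub (hC.comp h2))⟩

/-- The chart is a measure-preserving shear followed by a linear isomorphism and a translation, so
its Jacobian is constant. -/
theorem exists_integral_eq_smul_integral_graphChart [MeasurableSpace V] [BorelSpace V]
    (μ : Measure V) [μ.IsAddHaarMeasure] [MeasurableSpace E] [BorelSpace E] (ν : Measure E)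
    [ν.IsAddHaarMeasure] :
    ∃ c : ℝ, ∀ F : E → W, ∫ x, F x ∂ν = c • ∫ y, F (graphChart T hγ z y) ∂(μ.prod volume) := by
  have hν : (ν.map T.symm).IsAddHaarMeasure := T.symm.isAddHaarMeasure_map ν
  have hc := Measure.isAddLeftInvariant_eq_smul (ν.map T.symm) (μ.prod volume)
  set c := Measure.addHaarScalarFactor (ν.map T.symm) (μ.prod volume)
  refine ⟨c, fun F => ?_⟩
  have hS : MeasurePreserving (fun y : V × ℝ => (y.1, γ y.1 + y.2)) (μ.prod volume)
      (μ.prod volume) :=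
    (MeasurePreserving.id μ).skew_product (g := fun a b => γ a + b)
      (by fun_prop) (ae_of_all _ fun a => map_add_left_eq_self volume (γ a))
  have hSe : MeasurableEmbedding (fun y : V × ℝ => (y.1, γ y.1 + y.2)) := by
    let S : (V × ℝ) ≃ₜ (V × ℝ) :=
      { toFun := fun y => (y.1, γ y.1 + y.2)
        invFun := fun y => (y.1, y.2 - γ y.1)
        left_inv := fun y => by simp
        right_inv := fun y => by simp
        continuous_toFun := by fun_prop
        continuous_invFun := by fun_prop }
    exact S.measurableEmbedding
  calc ∫ x, F x ∂ν = ∫ x, F (z + x) ∂ν := (integral_add_left_eq_self F z).symm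
    _ = ∫ x, F (z + T (T.symm x)) ∂ν := by simp
    _ = ∫ w, F (z + T w) ∂(ν.map T.symm) :=
      (T.symm.toHomeomorph.measurableEmbedding.integral_map (fun w => F (z + T w))).symm
    _ = (c : ℝ) • ∫ w, F (z + T w) ∂(μ.prod volume) := by
      rw [hc, integral_smul_nnreal_measure]; rfl
    _ = _ := by rw [← hS.integral_comp hSe]; rfl

end GraphChart

/-! ### Height versus distance to the boundary. -/

section FlatCoordinates

variable {V E : Type*} [NormedAddCommGroup V] [NormedSpace ℝ V] [NormedAddCommGroup E]
  {Ω : Set E} {Ψ : (V × ℝ) ≃ₜ E} {r : ℝ}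

theorem mem_closure_of_flat (h : ∀ y, ‖y‖ < r → (Ψ y ∈ Ω ↔ 0 < y.2)) {y : V × ℝ} (hy : ‖y‖ < r)
    (hy2 : 0 ≤ y.2) : Ψ y ∈ closure Ω := by
  have hc : Tendsto (fun t : ℝ => (y.1, y.2 + t)) (𝓝[>] 0) (𝓝 y) := by
    have : Continuous fun t : ℝ => (y.1, y.2 + t) := by fun_prop
    have h0 := this.tendsto 0
    simp only [add_zero, Prod.mk.eta] at h0
    exact h0.mono_left nhdsWithin_le_nhds
  refine mem_closure_of_tendsto ((Ψ.continuous.tendsto y).comp hc) ?_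
  have hev : ∀ᶠ w in 𝓝 y, ‖w‖ < r := continuous_norm.continuousAt.eventually (gt_mem_nhds hy)
  filter_upwards [hc.eventually hev, self_mem_nhdsWithin] with t ht ht0
  exact (h _ ht).2 (add_pos_of_nonneg_of_pos hy2 ht0)

theorem snd_eq_zero_of_flat_of_mem_frontier (hΩ : IsOpen Ω)
    (h : ∀ y, ‖y‖ < r → (Ψ y ∈ Ω ↔ 0 < y.2)) {y : V × ℝ} (hy : ‖y‖ < r)
    (hy2 : Ψ y ∈ frontier Ω) : y.2 = 0 := by
  rcases lt_trichotomy y.2 0 with h0 | h0 | h0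
  · have h1 : y ∈ closure (Ψ ⁻¹' Ω) := by
      rw [← Ψ.preimage_closure]
      exact hy2.1
    have hev : ∀ᶠ w in 𝓝 y, ‖w‖ < r ∧ w.2 < 0 :=
      (continuous_norm.continuousAt.eventually (gt_mem_nhds hy)).and
        (continuous_snd.continuousAt.eventually (gt_mem_nhds h0))
    obtain ⟨w, hw, hw1, hw2⟩ := ((mem_closure_iff_frequently.1 h1).and_eventually hev).exists
    exact absurd ((h w hw1).1 hw) hw2.le.not_gt
  · exact h0
  · have := hy2.2
    rw [hΩ.interior_eq] at this
    exact absurd ((h y hy).2 h0) this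

theorem snd_le_mul_infDist_frontier (hΩ : IsOpen Ω) (h : ∀ y, ‖y‖ < r → (Ψ y ∈ Ω ↔ 0 < y.2))
    {L : NNReal} (hL : LipschitzWith L Ψ.symm) (hne : (frontier Ω).Nonempty) {y : V × ℝ}
    (hy : ‖y‖ < r / 2) : y.2 ≤ (L + 1) * Metric.infDist (Ψ y) (frontier Ω) := by
  have hL1 : (0 : ℝ) < L + 1 := by positivity
  have hy' : |y.2| < r / 2 := (norm_snd_le y).trans_lt hy
  rw [← div_le_iff₀' hL1, Metric.le_infDist hne]
  intro b hb
  rw [div_le_iff₀' hL1]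
  have h1 := hL.dist_le_mul (Ψ y) b
  rw [Ψ.symm_apply_apply, dist_eq_norm] at h1
  have h2 : y.2 ≤ ‖y - Ψ.symm b‖ := by
    -- A boundary point within the chart's range has height `0`; one beyond it is at coordinate
    -- distance at least `r / 2` from `y`, which already exceeds the height of `y`.
    rcases lt_or_ge ‖Ψ.symm b‖ r with h3 | h3
    · have := snd_eq_zero_of_flat_of_mem_frontier hΩ h h3 (by simpa using hb)
      have h4 := norm_snd_le (y - Ψ.symm b)
      rw [Prod.snd_sub, this, sub_zero] at h4
      exact (le_abs_self _).trans h4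
    · have := norm_sub_norm_le (Ψ.symm b) y
      rw [norm_sub_rev] at this
      linarith [le_abs_self y.2]
  have h5 : (0 : ℝ) ≤ dist (Ψ y) b := dist_nonneg
  linarith

end FlatCoordinates

/-! ### The weight in flat coordinates. -/

section Distance

variable {n : ℕ} {Ω : Set (EuclideanSpace ℝ (Fin n))} {d : EuclideanSpace ℝ (Fin n) → ℝ}

theorem infDist_frontier_pos (hΩ : IsOpen Ω) (hne : (frontier Ω).Nonempty)
    {x : EuclideanSpace ℝ (Fin n)} (hx : x ∈ Ω) : 0 < Metric.infDist x (frontier Ω) := by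
  refine (isClosed_frontier.notMem_iff_infDist_pos hne).1 fun h => ?_
  exact h.2 (by rwa [hΩ.interior_eq])

/-- Inside, `d` is `q` times the distance to the boundary; at the boundary `q` has a finite limit
and the distance tends to `0`. -/
theorem IsSmoothDistance.eq_zero_of_mem_frontier (hd : IsSmoothDistance Ω d) (hΩ : IsOpen Ω)
    {b : EuclideanSpace ℝ (Fin n)} (hb : b ∈ frontier Ω) : d b = 0 := by
  obtain ⟨U, q, hU, hUb, hq, hdq, -⟩ := hd.quotient
  have hbc : b ∈ closure Ω := hb.1
  have : (𝓝[Ω] b).NeBot := mem_closure_iff_nhdsWithin_neBot.1 hbc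
  have h1 : Tendsto d (𝓝[Ω] b) (𝓝 (d b)) :=
    (hd.contDiffOn.continuousOn b hbc).mono subset_closure
  have h2 : Tendsto q (𝓝[U ∩ Ω] b) (𝓝 (q b)) :=
    (hq.continuousOn b ⟨hUb hb, hbc⟩).mono (inter_subset_inter_right U subset_closure)
  rw [inter_comm, nhdsWithin_inter_of_mem' (mem_nhdsWithin_of_mem_nhds (hU.mem_nhds (hUb hb)))] at h2
  have h3 : Tendsto (fun x => Metric.infDist x (frontier Ω)) (𝓝[Ω] b) (𝓝 0) := by
    have := (Metric.continuous_infDist_pt (frontier Ω)).tendsto b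
    rw [Metric.infDist_zero_of_mem hb] at this
    exact this.mono_left nhdsWithin_le_nhds
  have h4 := h2.mul h3
  rw [mul_zero] at h4
  refine tendsto_nhds_unique (h1.congr' ?_) h4
  filter_upwards [self_mem_nhdsWithin, mem_nhdsWithin_of_mem_nhds (hU.mem_nhds (hUb hb))] with x hx hxU
  rw [← hdq x ⟨hxU, hx⟩, div_mul_cancel₀ _ (infDist_frontier_pos hΩ ⟨b, hb⟩ hx).ne']

/-- Produces the density left after extracting the factor `t ^ s` from `d ^ s • φ`. -/
theorem IsSmoothDistance.exists_tangentialCk {𝕜 : Type*} [RCLike 𝕜] {V : Type*}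
    [NormedAddCommGroup V] [NormedSpace ℝ V] [FiniteDimensional ℝ V] (hd : IsSmoothDistance Ω d)
    (hΩ : IsOpen Ω) {m : ℕ} {φ : EuclideanSpace ℝ (Fin n) → 𝕜}
    (hφ : ContDiffOn ℝ m φ (closure Ω)) {Ψ : (V × ℝ) ≃ₜ EuclideanSpace ℝ (Fin n)}
    (hΨ : ContDiff ℝ (m + 1) Ψ) {r : ℝ} (hr : 0 < r)
    (h : ∀ y, ‖y‖ < r → (Ψ y ∈ Ω ↔ 0 < y.2)) (hz : Ψ 0 ∈ frontier Ω) {L : NNReal}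
    (hL : LipschitzWith L Ψ.symm) (s : ℝ) :
    ∃ r', 0 < r' ∧ r' < r ∧ TangentialCk (Metric.ball (0 : V) r' ×ˢ Ioo 0 r') m
      (fun y => (y.2⁻¹ * d (Ψ y)) ^ s • φ (Ψ y)) := by
  obtain ⟨U, q, hU, hUb, hq, hdq, hqpos⟩ := hd.quotient
  have : ProperSpace V := FiniteDimensional.proper ℝ V
  have hqz := hqpos _ hz
  have hq1 : ∀ᶠ x in 𝓝[U ∩ closure Ω] (Ψ 0), q (Ψ 0) / 2 < q x :=
    (hq.continuousOn _ ⟨hUb hz, hz.1⟩).eventually (lt_mem_nhds (by linarith))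
  rw [inter_comm, nhdsWithin_inter_of_mem' (mem_nhdsWithin_of_mem_nhds (hU.mem_nhds (hUb hz)))] at hq1
  have hq2 : ∀ᶠ y in 𝓝 (0 : V × ℝ), Ψ y ∈ U ∧ (Ψ y ∈ closure Ω → q (Ψ 0) / 2 < q (Ψ y)) :=
    (Ψ.continuous.tendsto 0).eventually
      ((hU.eventually_mem (hUb hz)).and (eventually_nhdsWithin_iff.1 hq1))
  obtain ⟨r₁, hr₁, h₁⟩ := Metric.eventually_nhds_iff_ball.1 hq2
  set r' := min (r / 4) (r₁ / 2) with hr'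
  have hr'0 : 0 < r' := by positivity
  have hr'r : r' < r / 2 := (min_le_left _ _).trans_lt (by linarith)
  have hr'r₁ : r' < r₁ := (min_le_right _ _).trans_lt (by linarith)
  have hBn : ∀ y ∈ Metric.closedBall (0 : V) r' ×ˢ Icc 0 r', ‖y‖ ≤ r' := by
    intro y hy
    rw [Prod.norm_def, Real.norm_of_nonneg hy.2.1]
    exact max_le (by simpa using hy.1) hy.2.2
  have hBΩ : MapsTo Ψ (Metric.closedBall (0 : V) r' ×ˢ Icc 0 r') (closure Ω) := fun y hy =>
    mem_closure_of_flat h ((hBn y hy).trans_lt (by linarith)) hy.2.1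
  have hAB : Metric.ball (0 : V) r' ×ˢ Ioo 0 r' ⊆ Metric.closedBall (0 : V) r' ×ˢ Icc 0 r' :=
    prod_mono Metric.ball_subset_closedBall Ioo_subset_Icc_self
  have hBu : UniqueDiffOn ℝ (Metric.closedBall (0 : V) r' ×ˢ Icc (0 : ℝ) r') :=
    (uniqueDiffOn_convex (convex_closedBall 0 r')
      ⟨0, Metric.ball_subset_interior_closedBall (Metric.mem_ball_self hr'0)⟩).prod
      (uniqueDiffOn_Icc hr'0)
  have hφ' : TangentialCk (Metric.ball (0 : V) r' ×ˢ Ioo 0 r') m (fun y => φ (Ψ y)) :=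
    (hφ.comp (hΨ.of_le (by exact_mod_cast Nat.le_succ m)).contDiffOn hBΩ).tangentialCk
      ((isCompact_closedBall 0 r').prod isCompact_Icc) hBu
      (interior_maximal hAB (Metric.isOpen_ball.prod isOpen_Ioo))
  have hd' : TangentialCk (Metric.ball (0 : V) r' ×ˢ Ioo 0 r') m (fun y => y.2⁻¹ * d (Ψ y)) := by
    refine ContDiffOn.tangentialCk_inv_mul hr'0 (f := fun y => d (Ψ y)) ?_ fun y hy => ?_
    · exact (hd.contDiffOn.of_le (by exact_mod_cast le_top)).comp hΨ.contDiffOn hBΩ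
    · refine hd.eq_zero_of_mem_frontier hΩ ?_
      have hyr : ‖(y, (0 : ℝ))‖ < r := by
        rw [Prod.norm_def]
        simp only [norm_zero]
        exact max_lt ((mem_closedBall_zero_iff.1 hy).trans_lt (by linarith)) hr
      rw [frontier, hΩ.interior_eq]
      exact ⟨mem_closure_of_flat h hyr le_rfl, fun h' => lt_irrefl _ ((h _ hyr).1 h')⟩
  -- The quotient `q` exceeds half its value at the centre, and the height is at most `L + 1` times
  -- the distance to the boundary.
  have hlow : ∀ y ∈ Metric.ball (0 : V) r' ×ˢ Ioo 0 r',
      q (Ψ 0) / 2 / (L + 1) ≤ y.2⁻¹ * d (Ψ y) := by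
    intro y hy
    have hyn := hBn y (hAB hy)
    have hy2 : 0 < y.2 := hy.2.1
    have hyΩ : Ψ y ∈ Ω := (h y (by linarith)).2 hy2
    obtain ⟨hyU, hyq⟩ := h₁ y (by simpa using hyn.trans_lt hr'r₁)
    have hpos := infDist_frontier_pos hΩ ⟨_, hz⟩ hyΩ
    have h2 := snd_le_mul_infDist_frontier hΩ h hL ⟨_, hz⟩ (hyn.trans_lt hr'r)
    have h3 := hdq _ ⟨hyU, hyΩ⟩
    rw [div_eq_iff hpos.ne'] at h3
    have h4 := (hyq (subset_closure hyΩ)).le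
    have hL1 : (0 : ℝ) < L + 1 := by positivity
    rw [h3, ← div_eq_inv_mul, le_div_iff₀ hy2, div_mul_eq_mul_div, div_le_iff₀ hL1]
    calc _ ≤ q (Ψ 0) / 2 * ((L + 1) * Metric.infDist (Ψ y) (frontier Ω)) := by gcongr
      _ = q (Ψ 0) / 2 * Metric.infDist (Ψ y) (frontier Ω) * (L + 1) := by ring
      _ ≤ _ := by gcongr
  exact ⟨r', hr'0, by linarith, (hd'.rpow_const (by positivity) hlow s).smul hφ'⟩

end Distance

/-! ### The localized potential in flat coordinates. -/

section NearPart

variable {V E W : Type*} [NormedAddCommGroup V] [NormedSpace ℝ V] [FiniteDimensional ℝ V]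
  [MeasurableSpace V] [BorelSpace V] (μ : Measure V) [μ.IsAddHaarMeasure]
  [NormedAddCommGroup E] [InnerProductSpace ℝ E] [FiniteDimensional ℝ E]
  [NormedAddCommGroup W] [NormedSpace ℝ W] (T : (V × ℝ) ≃L[ℝ] E)
  {γ : V → ℝ} (hγ : Continuous γ) (z : E)

/-- In graph coordinates, the Riesz potential of a density supported near the origin is a
half-space potential at the points of the graph. -/
theorem integral_graphChart_eq_halfSpacePotential {s p r R : ℝ} {Ξ : V × E × E → ℝ}
    (hR : ∀ w, ‖w‖ ≤ 2 * r → ‖T w‖ ≤ R) (hrR : r ≤ R)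
    (hΞ : ∀ x w, ‖x‖ ≤ R → ‖T w‖ ≤ R → w ≠ 0 →
        singularKernel p Ξ x (T w) = ‖T (w.1, w.2 + (γ (x + w.1) - γ x))‖ ^ (-p))
    {g : V × ℝ → W} (hg : ∀ y, r < ‖y‖ → g y = 0) {x : V} (hx : ‖x‖ ≤ r) :
    ∫ y in {y : V × ℝ | 0 < y.2},
      (y.2 ^ s * ‖graphChart T hγ z (x, 0) - graphChart T hγ z y‖ ^ (-p)) • g y ∂(μ.prod volume) =
    halfSpacePotential μ T s p Ξ g x := by
  have hm : MeasurableSet {w : V × ℝ | 0 < w.2} :=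
    (isOpen_lt continuous_const continuous_snd).measurableSet
  rw [halfSpacePotential, ← integral_indicator hm, ← integral_indicator hm,
    ← integral_add_left_eq_self _ ((x, 0) : V × ℝ)]
  refine integral_congr_ae (ae_of_all _ fun w => ?_)
  simp only [indicator_apply, mem_ofPred_eq, Prod.snd_add, zero_add]
  split_ifs with hw
  · have hxw : (x, (0 : ℝ)) + w = (x + w.1, w.2) := by ext <;> simp
    rw [hxw]
    by_cases hgw : g (x + w.1, w.2) = 0
    · simp [hgw]
    have h1 : ‖(x + w.1, w.2)‖ ≤ r := not_lt.1 fun h => hgw (hg _ h)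
    have h2 : ‖w‖ ≤ 2 * r := by
      have h3 : w = (x + w.1, w.2) - (x, 0) := by ext <;> simp
      have h4 : ‖(x, (0 : ℝ))‖ = ‖x‖ := by simp [Prod.norm_def]
      rw [h3]
      refine (norm_sub_le _ _).trans ?_
      rw [h4]
      linarith
    have hw0 : w ≠ 0 := by rintro rfl; simp at hw
    rw [hΞ x w (hx.trans hrR) (hR w h2) hw0, norm_sub_rev]
    congr 4
    rw [graphChart_apply, graphChart_apply, add_sub_add_left_eq_sub, ← map_sub]
    congr 1
    ext
    · simp
    · simp only [Prod.snd_sub]; ring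
  · rfl

end NearPart

/-! ### Assembly of the near and far parts. -/

section Main

variable {𝕜 : Type*} [RCLike 𝕜] {n : ℕ} {Ω : Set (EuclideanSpace ℝ (Fin n))}
  {d : EuclideanSpace ℝ (Fin n) → ℝ} {φ : EuclideanSpace ℝ (Fin n) → 𝕜} {s : ℝ}

theorem potentialIntegrand_eq_smul (s : ℝ) (d : EuclideanSpace ℝ (Fin n) → ℝ)
    (φ : EuclideanSpace ℝ (Fin n) → 𝕜) (x y : EuclideanSpace ℝ (Fin n)) :
    potentialIntegrand s d φ x y =
      ‖x - y‖ ^ (-((n : ℝ) + 2 * s - 2)) • (d y ^ s • φ y) := by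
  rw [potentialIntegrand, smul_smul, Real.rpow_neg (norm_nonneg _), div_eq_inv_mul]

theorem exists_local_extension_potentialF (hs : 0 ≤ s) (hs' : s < 1) (hn : 2 ≤ n)
    (hΩ : IsOpen Ω) (hΩb : Bornology.IsBounded Ω) (hΩs : HasSmoothBoundary Ω)
    (hd : IsSmoothDistance Ω d) {m : ℕ} (hφ : ContDiffOn ℝ m φ (closure Ω))
    {C : ℝ} (hC : ∀ y ∈ Ω, ‖d y ^ s • φ y‖ ≤ C)
    (hmeas : AEStronglyMeasurable (fun y => d y ^ s • φ y) (volume.restrict Ω))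
    {z : EuclideanSpace ℝ (Fin n)} (hz : z ∈ frontier Ω) :
    ∃ (U : Set (EuclideanSpace ℝ (Fin n))) (G : EuclideanSpace ℝ (Fin n) → 𝕜),
      IsOpen U ∧ z ∈ U ∧ ContDiff ℝ (m + 1) G ∧ EqOn (potentialF Ω s d φ) G (frontier Ω ∩ U) := by
  -- Hadamard's lemma loses one derivative, and the profile must be of class `C^(m+1)`.
  obtain ⟨V, T, γ, r, hr, hγN, hγc, hγ0, hflat⟩ := hΩs.exists_graph hz (m + 2)
  push_cast at hγN
  set p : ℝ := (n : ℝ) + 2 * s - 2 with hp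
  have hγN' : ContDiff ℝ ((m + 1 : ℕ) + 1) γ := by push_cast; rwa [add_assoc, one_add_one_eq_two]
  have hγ1 : ContDiff ℝ (m + 1) γ := hγN.of_le (by gcongr; exact one_le_two)
  have hγ : Continuous γ := hγN.continuous
  have hrank : Module.finrank ℝ V + 1 = n := by
    have := T.toLinearEquiv.finrank_eq
    simpa using this
  have : Nontrivial V := Module.nontrivial_of_finrank_pos (R := ℝ) (by omega)
  have hpV : p = Module.finrank ℝ V + 2 * s - 1 := by
    have hrank' : (n : ℝ) = Module.finrank ℝ V + 1 := by exact_mod_cast hrank.symm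
    linarith
  set Ψ := graphChart T hγ z with hΨ
  have hΨ0 : Ψ.symm z = 0 := graphChart_symm_self T hγ z hγ0
  have hΨz : Ψ 0 = z := by rw [← hΨ0, Ψ.apply_symm_apply]
  obtain ⟨L, hL⟩ := exists_lipschitzWith_graphChart_symm T hγ z
    (hγ1.of_le (by exact_mod_cast Nat.le_add_left 1 m)) hγc
  have h : ∀ y, ‖y‖ < r → (Ψ y ∈ Ω ↔ 0 < y.2) := fun y hy =>
    hflat y.1 y.2 ((norm_fst_le y).trans_lt hy) ((norm_snd_le y).trans_lt hy)
  obtain ⟨r', hr', hr'r, hg₀⟩ := hd.exists_tangentialCk hΩ hφ (contDiff_graphChart T hγ z hγ1) hr h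
    (by rwa [hΨz]) hL s
  let χ : ContDiffBump (0 : V × ℝ) := ⟨r' / 4, r' / 2, by positivity, by linarith⟩
  let g : V × ℝ → 𝕜 := fun y => χ y • ((y.2⁻¹ * d (Ψ y)) ^ s • φ (Ψ y))
  have hχ0 : ∀ y, r' / 2 ≤ ‖y‖ → χ y = 0 := fun y hy => χ.zero_of_le_dist (by simpa using hy)
  have hg0 : ∀ y, r' / 2 < ‖y‖ → g y = 0 := fun y hy => by simp [g, hχ0 y hy.le]
  have hA : IsOpen (Metric.ball (0 : V) r' ×ˢ Ioo 0 r') := Metric.isOpen_ball.prod isOpen_Ioo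
  have hg : TangentialCk {w : V × ℝ | 0 < w.2} m g := by
    have hχ : TangentialCk (Metric.ball (0 : V) r' ×ˢ Ioo 0 r') m χ := by
      refine (χ.contDiff (n := m)).contDiffOn.tangentialCk
        (B := Metric.closedBall (0 : V) r' ×ˢ Icc 0 r')
        ((isCompact_closedBall 0 r').prod isCompact_Icc) ?_
        (interior_maximal (prod_mono Metric.ball_subset_closedBall Ioo_subset_Icc_self) hA)
      exact (uniqueDiffOn_convex (convex_closedBall 0 r')
        ⟨0, Metric.ball_subset_interior_closedBall (Metric.mem_ball_self hr')⟩).prod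
        (uniqueDiffOn_Icc hr')
    refine (hχ.smul hg₀).of_eq_zero_off hA (K := Metric.closedBall 0 (r' / 2))
      Metric.isClosed_closedBall (fun y hy => hg0 y (by simpa using hy)) fun y hy => ?_
    by_cases hyK : ‖y‖ ≤ r' / 2
    · refine Or.inl ⟨?_, hy, ?_⟩
      · exact mem_ball_zero_iff.2 ((norm_fst_le y).trans_lt (by linarith))
      · exact (le_abs_self _).trans_lt ((norm_snd_le y).trans_lt (by linarith))
    · exact Or.inr (by simpa using hyK)
  -- Differences of two points of the ball of radius `r'` have norm at most `2 * r'`; the summand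
  -- `r'` makes `R` bound the base points as well.
  set R := ‖(T : V × ℝ →L[ℝ] EuclideanSpace ℝ (Fin n))‖ * (2 * r') + r' with hR
  have hR0 : 0 < R := by positivity
  obtain ⟨Ξ, hΞ, hΞc, hΞT⟩ := exists_profile_graph T hγN' p R hR0
  push_cast at hΞ
  have hI := contDiff_halfSpacePotential (volume : Measure V) T hs hs' hpV m hΞ hΞc hg
  obtain ⟨c, hc⟩ := exists_integral_eq_smul_integral_graphChart (W := 𝕜) T hγ z
    (volume : Measure V) (volume : Measure (EuclideanSpace ℝ (Fin n)))
  let χE : EuclideanSpace ℝ (Fin n) → ℝ := fun y => χ (Ψ.symm y)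
  have hχEc : Continuous χE := χ.continuous.comp Ψ.symm.continuous
  have hfr : 1 ≤ Module.finrank ℝ (EuclideanSpace ℝ (Fin n)) := by
    rw [finrank_euclideanSpace_fin]; omega
  have hpn : p < Module.finrank ℝ (EuclideanSpace ℝ (Fin n)) := by
    rw [finrank_euclideanSpace_fin, hp]; linarith
  have hC0 : ∀ y ∈ Ω, 0 ≤ C := fun y hy => (norm_nonneg _).trans (hC y hy)
  have hint : ∀ (f : EuclideanSpace ℝ (Fin n) → ℝ), Continuous f → (∀ y, |f y| ≤ 1) → ∀ x,
      IntegrableOn (fun y => ‖x - y‖ ^ (-p) • (f y • (d y ^ s • φ y))) Ω := by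
    intro f hf hf1 x
    refine integrableOn_norm_sub_rpow_smul volume hΩb hΩ.measurableSet hfr hpn
      (hf.aestronglyMeasurable.smul hmeas) (C := C) (fun y hy => ?_) x
    refine (norm_smul (f y) (d y ^ s • φ y)).trans_le ?_
    calc _ ≤ 1 * C := mul_le_mul (hf1 y) (hC y hy) (norm_nonneg _) zero_le_one
      _ = C := one_mul C
  have hχE1 : ∀ y, |χE y| ≤ 1 := fun y => abs_le.2 ⟨by linarith [χ.nonneg (x := Ψ.symm y)], χ.le_one⟩
  have hχE1' : ∀ y, |1 - χE y| ≤ 1 := fun y =>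
    abs_le.2 ⟨by linarith [χ.le_one (x := Ψ.symm y)], by linarith [χ.nonneg (x := Ψ.symm y)]⟩
  obtain ⟨ε, hε, hεχ⟩ : ∃ ε > 0, ∀ y ∈ Metric.ball z ε, χE y = 1 := by
    have h1 : ∀ᶠ y in 𝓝 z, χE y = 1 := by
      have h2 : Tendsto Ψ.symm (𝓝 z) (𝓝 0) := by
        have := Ψ.symm.continuous.tendsto z
        rwa [hΨ0] at this
      exact h2.eventually χ.eventuallyEq_one
    exact Metric.eventually_nhds_iff_ball.1 h1
  obtain ⟨R', hR', hΩR'⟩ := hΩb.exists_pos_norm_lt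
  have hh : Integrable (Ω.indicator fun y => (1 - χE y) • (d y ^ s • φ y)) := by
    rw [integrable_indicator_iff hΩ.measurableSet]
    refine Integrable.mono' (g := fun _ => C) (integrableOn_const hΩb.measure_lt_top.ne)
      ((continuous_const.sub hχEc).aestronglyMeasurable.smul hmeas) ?_
    filter_upwards [ae_restrict_mem hΩ.measurableSet] with y hy
    rw [norm_smul]
    calc _ ≤ 1 * C := mul_le_mul (hχE1' y) (hC y hy) (norm_nonneg _) zero_le_one
      _ = C := one_mul C
  obtain ⟨G₂, hG₂, hG₂eq⟩ := exists_contDiff_eq_integral_norm_sub_rpow volume hh (R := R')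
    (fun y hy => indicator_of_notMem (fun hyΩ => (hΩR' y hyΩ).not_ge hy) _) (z := z) hε
    (fun y hy => by simp [hεχ y hy]) p (m + 1)
  push_cast at hG₂
  -- The near part is extended off the boundary as a function of the tangential coordinate alone; it
  -- represents the potential only at height `0`.
  refine ⟨Ψ.symm ⁻¹' Metric.ball 0 (r' / 2) ∩ Metric.ball z (ε / 2),
    fun x => c • halfSpacePotential volume T s p Ξ g (Ψ.symm x).1 + G₂ x,
    (Metric.isOpen_ball.preimage Ψ.symm.continuous).inter Metric.isOpen_ball,
    ⟨by simp [hΨ0, hr'], Metric.mem_ball_self (by positivity)⟩,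
    ((hI.comp (contDiff_graphChart_symm_fst T hγ z)).const_smul c).add hG₂, ?_⟩
  rintro x ⟨hxΩ, hxr, hxε⟩
  have hxr' : ‖Ψ.symm x‖ < r' / 2 := by simpa using hxr
  have hx2 : (Ψ.symm x).2 = 0 :=
    snd_eq_zero_of_flat_of_mem_frontier hΩ h (hxr'.trans (by linarith)) (by simpa using hxΩ)
  have hxΨ : Ψ ((Ψ.symm x).1, 0) = x := by rw [← hx2, Prod.mk.eta, Ψ.apply_symm_apply]
  have hsplit : potentialF Ω s d φ x =
      (∫ y in Ω, ‖x - y‖ ^ (-p) • (χE y • (d y ^ s • φ y))) +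
        ∫ y in Ω, ‖x - y‖ ^ (-p) • ((1 - χE y) • (d y ^ s • φ y)) := by
    rw [← integral_add (hint _ hχEc hχE1 x) 
      (hint (fun y => 1 - χE y) (continuous_const.sub hχEc) hχE1' x), potentialF]
    refine integral_congr_ae (ae_of_all _ fun y => ?_)
    simp only [potentialIntegrand_eq_smul]
    rw [← smul_add, ← add_smul, add_sub_cancel, one_smul]
  have hfar : ∫ y in Ω, ‖x - y‖ ^ (-p) • ((1 - χE y) • (d y ^ s • φ y)) = G₂ x := by
    rw [← hG₂eq x hxε, ← integral_indicator hΩ.measurableSet]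
    refine integral_congr_ae (ae_of_all _ fun y => ?_)
    by_cases hy : y ∈ Ω <;> simp [hy]
  have hnear : ∫ y in Ω, ‖x - y‖ ^ (-p) • (χE y • (d y ^ s • φ y)) =
      c • halfSpacePotential volume T s p Ξ g (Ψ.symm x).1 := by
    have hm : MeasurableSet {w : V × ℝ | 0 < w.2} :=
      (isOpen_lt continuous_const continuous_snd).measurableSet
    have hTR : ∀ w, ‖w‖ ≤ 2 * r' → ‖T w‖ ≤ R := by
      intro w hw
      refine ((T : V × ℝ →L[ℝ] EuclideanSpace ℝ (Fin n)).le_opNorm w).trans ?_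
      have := mul_le_mul_of_nonneg_left hw
        (norm_nonneg (T : V × ℝ →L[ℝ] EuclideanSpace ℝ (Fin n)))
      linarith
    have hrR : r' ≤ R := by
      have : 0 ≤ ‖(T : V × ℝ →L[ℝ] EuclideanSpace ℝ (Fin n))‖ * (2 * r') := by positivity
      linarith
    rw [← integral_graphChart_eq_halfSpacePotential volume T hγ z (r := r') (R := R)
      hTR hrR hΞT (fun y hy => hg0 y (by linarith))
      ((norm_fst_le _).trans (by linarith : ‖Ψ.symm x‖ ≤ r')), ← integral_indicator hΩ.measurableSet,
      hc, ← integral_indicator hm]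
    congr 1
    refine integral_congr_ae (ae_of_all _ fun y => ?_)
    beta_reduce
    -- Outside the cutoff both integrands vanish, so the flat description of `Ω` is used only where
    -- it is valid.
    by_cases hy : r' / 2 ≤ ‖y‖
    · simp [indicator, g, χE, ← hΨ, hχ0 y hy]
    have hyr : ‖y‖ < r := by linarith
    by_cases hy2 : 0 < y.2
    · have hyΩ : Ψ y ∈ Ω := (h y hyr).2 hy2
      -- This extracts the weight `t ^ s` of the half-space potential.
      have hdy : d (Ψ y) ^ s = y.2 ^ s * (y.2⁻¹ * d (Ψ y)) ^ s := by
        have hdpos := hd.pos _ hyΩ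
        rw [← Real.mul_rpow hy2.le (by positivity), mul_inv_cancel_left₀ hy2.ne']
      rw [← hΨ, indicator_of_mem hyΩ, indicator_of_mem (by exact hy2)]
      simp only [g, χE, Ψ.symm_apply_apply, hxΨ, smul_smul]
      rw [hdy]
      congr 1
      ring
    · rw [← hΨ, indicator_of_notMem (fun h' => hy2 ((h y hyr).1 h')),
        indicator_of_notMem (by exact hy2)]
  rw [hsplit, hfar, hnear]

end Main

theorem lemma3p5 {𝕜 : Type*} [RCLike 𝕜] (n : ℕ) (s : ℝ)
    (hns : (n = 2 ∧ 0 < s ∧ s < 1) ∨ (3 ≤ n ∧ 0 ≤ s ∧ s < 1))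
    (Ω : Set (EuclideanSpace ℝ (Fin n)))
    (hΩ_open : IsOpen Ω) (hΩ_conn : IsConnected Ω) (hΩ_bdd : Bornology.IsBounded Ω)
    (hΩ_smooth : HasSmoothBoundary Ω)
    (d : EuclideanSpace ℝ (Fin n) → ℝ) (hd : IsSmoothDistance Ω d)
    (m : ℕ) (φ : EuclideanSpace ℝ (Fin n) → 𝕜) (hφ : ContDiffOn ℝ m φ (closure Ω)) :
    (∀ x ∈ closure Ω, MeasureTheory.IntegrableOn (potentialIntegrand s d φ x) Ω) ∧
      IsCkOnSurface (m + 1) (frontier Ω) (potentialF Ω s d φ) := by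
  have hs : 0 ≤ s := by rcases hns with h | h <;> linarith [h.2.1]
  have hs' : s < 1 := by rcases hns with h | h <;> exact h.2.2
  have hn : 2 ≤ n := by rcases hns with h | h <;> omega
  have hcont : ContinuousOn (fun y => d y ^ s • φ y) (closure Ω) :=
    (hd.contDiffOn.continuousOn.rpow_const fun _ _ => Or.inr hs).smul hφ.continuousOn
  obtain ⟨C, hC⟩ := hΩ_bdd.isCompact_closure.exists_bound_of_continuousOn hcont
  have hmeas : AEStronglyMeasurable (fun y => d y ^ s • φ y) (volume.restrict Ω) :=
    (hcont.mono subset_closure).aestronglyMeasurable hΩ_open.measurableSet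
  refine ⟨fun x _ => ?_, fun z hz => ?_⟩
  · have h := integrableOn_norm_sub_rpow_smul volume hΩ_bdd hΩ_open.measurableSet
      (p := (n : ℝ) + 2 * s - 2) (by rw [finrank_euclideanSpace_fin]; omega)
      (by rw [finrank_euclideanSpace_fin]; linarith) hmeas
      (fun y hy => hC y (subset_closure hy)) x
    exact h.congr_fun (fun y _ => (potentialIntegrand_eq_smul s d φ x y).symm)
      hΩ_open.measurableSet
  · obtain ⟨U, G, hU, hzU, hG, hUG⟩ := exists_local_extension_potentialF hs hs' hn hΩ_open hΩ_bdd
      hΩ_smooth hd hφ (fun y hy => hC y (subset_closure hy)) hmeas hz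
    exact ⟨U, G, hU, hzU, by simpa using hG.contDiffOn, hUG⟩
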